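/- Let $M\ge 1$ and $m\ge 0$ be integers such that $\gcd(M,2m+2)=1$ if $m>0$. For $\tau\in\mathbb C$ with $\operatorname{Im}\tau>0$ put $q=e^{2\pi i\tau}$ and let $z_1,z_2,z,v,t\in\mathbb C$. For an integer $k\ge1$ and $j\in\mathbb Z$ put $$\Theta_{j,k}(\tau,z)=\sum_{n\in\mathbb Z+\frac{j}{2k}}q^{kn^2}e^{2\pi i knz},\qquad E(x)=2\int_0^x e^{-\pi u^2}\,du,$$ $$R_{k;j}(\tau,v)=\sum_{n\in\mathbb Z,\ n\equiv j\,(2k)}\Big(\operatorname{sign}(n+\tfrac12)-E\Big(\big(n+2k\tfrac{\operatorname{Im}v}{\operatorname{Im}\tau}\big)\big(\tfrac{\operatorname{Im}\tau}{k}\big)^{1/2}\Big)\Big)e^{-\frac{\pi i n^2}{2k}\tau-2\pi i nv}.$$ Let $$\Phi^{[m]}(\tau,z_1,z_2,t)=e^{2\pi i(m+1)t}\sum_{j\in\mathbb Z}\left(\frac{e^{2\pi ij(m+1)(z_1+z_2)}q^{j^2(m+1)}}{1-e^{2\pi iz_1}q^j}-\frac{e^{-2\pi ij(m+1)(z_1+z_2)}q^{j^2(m+1)}}{1-e^{-2\pi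 iz_2}q^j}\right),$$ which is defined when $z_1,z_2\notin\mathbb Z+\tau\mathbb Z$, and $$\tilde\Phi^{[m]}(\tau,z_1,z_2,t)=\Phi^{[m]}(\tau,z_1,z_2,t)-\tfrac12e^{2\pi i(m+1)t}\sum_{j\in\mathbb Z/(2m+2)\mathbb Z}R_{m+1;j}\big(\tau,\tfrac{z_1-z_2}2\big)\,\big(\Theta_{j,m+1}-\Theta_{-j,m+1}\big)(\tau,z_1+z_2).$$ For $\epsilon,\epsilon'\in\{0,\tfrac12\}$ and $j,k\in\epsilon'+\mathbb Z$ put $$\tilde\Psi^{[M,m;\epsilon]}_{j,k;\epsilon'}(\tau,z_1,z_2,t)=q^{\frac{(m+1)jk}{M}}e^{\frac{2\pi i(m+1)}{M}(kz_1+jz_2)}\,\tilde\Phi^{[m]}\Big(M\tau,\,z_1+j\tau+\epsilon,\,z_2+k\tau+\epsilon,\,\frac tM\Big).$$ **Theorem.** Let $\epsilon,\epsilon'\in\{0,\tfrac12\}$ and $j,k\in\epsilon'+\mathbb Z$. Then, for all $z_1,z_2,t\in\mathbb C$ and $\tau$ with $\operatorname{Im}\tau>0$ such that all the terms are defined, $$\tilde\Psi^{[M,m;\epsilon]}_{j,k;\epsilon'}\Big(-\frac1\tau,\frac{z_1}\tau,\frac{z_2}\tau,t\Big)=\frac{\tau}{M}\,e^{\frac{2\pi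 i(m+1)}{M}\frac{z_1z_2}{\tau}}\sum_{a,b\in\epsilon+\mathbb Z/M\mathbb Z}e^{-\frac{2\pi i(m+1)}{M}(ak+bj)}\,\tilde\Psi^{[M,m;\epsilon']}_{a,b;\epsilon}(\tau,z_1,z_2,t),$$ where $(a,b)$ may run through any set of representatives of $(\epsilon+\mathbb Z)^2$ modulo $(M\mathbb Z)^2$, and $$\tilde\Psi^{[M,m;\epsilon]}_{j,k;\epsilon'}(\tau+1,z_1,z_2,t)=e^{2\pi i\frac{(m+1)jk}{M}}\,\tilde\Psi^{[M,m;\epsilon+\epsilon']}_{j,k;\epsilon'}(\tau,z_1,z_2,t),$$ where the superscript $\epsilon+\epsilon'$ may be read modulo $\mathbb Z$ (so that $\tfrac12+\tfrac12$ is $0$). -/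

import Mathlib

open Complex

noncomputable section

/-- The odd entire function `E(x) = 2 ∫₀ˣ exp(-π u²) du`, at real arguments. -/
def errE (x : ℝ) : ℝ := 2 * ∫ u in (0 : ℝ)..x, Real.exp (-Real.pi * u ^ 2)

/-- The real analytic function `R_{k;j}(τ, v)` of Zwegers: the sum over the integers
`n ≡ j mod 2k`, written as `n = j + 2 k l` with `l ∈ ℤ`, of
`(sign(n + 1/2) - E((n + 2k Im v / Im τ) (Im τ / k)^{1/2})) exp(-π i n² τ / (2k) - 2π i n v)`. -/
def zwegersR (k : ℕ) (j : ℤ) (τ v : ℂ) : ℂ :=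
  ∑' l : ℤ,
    ((Real.sign (((j + 2 * k * l : ℤ) : ℝ) + 1 / 2)
        - errE ((((j + 2 * k * l : ℤ) : ℝ) + 2 * k * (v.im / τ.im)) * Real.sqrt (τ.im / k)) : ℝ) : ℂ)
      * cexp (-(Real.pi * I * ((j + 2 * k * l : ℤ) : ℂ) ^ 2 / (2 * k)) * τ
          - 2 * Real.pi * I * ((j + 2 * k * l : ℤ) : ℂ) * v)

/-- The Jacobi form `Θ_{j,k}(τ, z) = ∑_{n ∈ ℤ + j/(2k)} q^{k n²} exp(2π i k n z)`,
where `q = exp(2π i τ)`. -/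
def thetaJK (j : ℤ) (k : ℕ) (τ z : ℂ) : ℂ :=
  ∑' n : ℤ, cexp (2 * Real.pi * I * τ * (k * (n + j / (2 * k)) ^ 2)
    + 2 * Real.pi * I * k * (n + j / (2 * k)) * z)

/-- The mock theta function `Φ^{[m]}(τ, z₁, z₂, t)`. -/
def mockPhi (m : ℕ) (τ z₁ z₂ t : ℂ) : ℂ :=
  cexp (2 * Real.pi * I * (m + 1) * t) *
    ∑' j : ℤ,
      (cexp (2 * Real.pi * I * j * (m + 1) * (z₁ + z₂))
            * cexp (2 * Real.pi * I * τ * (j ^ 2 * (m + 1)))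
          / (1 - cexp (2 * Real.pi * I * z₁) * cexp (2 * Real.pi * I * τ * j))
        - cexp (-(2 * Real.pi * I * j * (m + 1) * (z₁ + z₂)))
            * cexp (2 * Real.pi * I * τ * (j ^ 2 * (m + 1)))
          / (1 - cexp (-(2 * Real.pi * I * z₂)) * cexp (2 * Real.pi * I * τ * j)))

/-- No denominator in the series `mockPhi` vanishes at `(τ, z₁, z₂)`, that is,
neither `z₁` nor `z₂` lies in `ℤ + τ ℤ`. -/
def PhiDefinedAt (τ z₁ z₂ : ℂ) : Prop :=
  ∀ j : ℤ, 1 - cexp (2 * Real.pi * I * z₁) * cexp (2 * Real.pi * I * τ * j) ≠ 0 ∧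
    1 - cexp (-(2 * Real.pi * I * z₂)) * cexp (2 * Real.pi * I * τ * j) ≠ 0

/-- The correction `Φ_add^{[m]}(τ, z₁, z₂, t)`; the summand depends on `j` only modulo `2m + 2`. -/
def corrPhi (m : ℕ) (τ z₁ z₂ t : ℂ) : ℂ :=
  -(1 / 2) * cexp (2 * Real.pi * I * (m + 1) * t) *
    ∑ j ∈ Finset.range (2 * m + 2),
      zwegersR (m + 1) j τ ((z₁ - z₂) / 2)
        * (thetaJK j (m + 1) τ (z₁ + z₂) - thetaJK (-(j : ℤ)) (m + 1) τ (z₁ + z₂))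

/-- The modified function `Φ̃^{[m]} = Φ^{[m]} + Φ_add^{[m]}`. -/
def modPhi (m : ℕ) (τ z₁ z₂ t : ℂ) : ℂ := mockPhi m τ z₁ z₂ t + corrPhi m τ z₁ z₂ t

/-- The function `Ψ̃^{[M,m;ε]}_{j,k;ε'}(τ, z₁, z₂, t)`, for indices `j, k ∈ ε' + ℤ`. The label `ε'`
is not an argument: it only records the common class of `j` and `k` modulo `ℤ`, and does not
enter the formula otherwise. -/
def modPsi (M m : ℕ) (ε j k : ℂ) (τ z₁ z₂ t : ℂ) : ℂ :=
  cexp (2 * Real.pi * I * τ * ((m + 1) * j * k / M))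
    * cexp (2 * Real.pi * I * (m + 1) / M * (k * z₁ + j * z₂))
    * modPhi m (M * τ) (z₁ + j * τ + ε) (z₂ + k * τ + ε) (t / M)

/-- The point `(τ, z₁, z₂)` is not on the polar locus of `modPsi M m ε j k`. -/
def PsiDefinedAt (M : ℕ) (ε j k : ℂ) (τ z₁ z₂ : ℂ) : Prop :=
  PhiDefinedAt (M * τ) (z₁ + j * τ + ε) (z₂ + k * τ + ε)

end

open Complex
open Real (pi)
open scoped ComplexConjugate

/-! ### The error function -/

/-! The completed function is a lattice sum, and lattice sums are visibly modular. With `K = m + 1`,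
`modPhi` equals, up to an elementary factor, `latSum K τ z₁ z₂ + latSum K τ z₂ z₁`, where each
`latSum` adds simple poles `1 / (z₁ + λ)` over `λ ∈ ℤτ + ℤ`, damped by a Gaussian and twisted by a
phase (`modPhi_eq_latSum`).

To see this, sum over each row `λ = jτ + a`, `a ∈ ℤ`. The one-dimensional identity
`tsum_gaussian_div_eq` turns a row into a geometric term, which is a summand of `mockPhi`, plus a
series with coefficients `sign - E`. Completing squares, these series reassemble into the products
of `zwegersR` and `thetaJK` in `corrPhi`.

Consequently `modPsi` is a sum of two functions `psiHalf`, supported on `(J, N)` with `J ∈ j + Mℤ`,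
`N ∈ ε + ℤ`, resp. `J ∈ k + Mℤ`. Since `|ω|² / Im τ` is invariant under changes of lattice basis, `τ
↦ τ + 1` merely shears the index set (`psiHalf_add_one`), while `τ ↦ -1/τ` exchanges the roles of
`J` and `N` (`gaussPole_neg_inv`), moving the congruence modulo `M` from one coordinate to the
other. On the right side, the sum over `a` removes the congruence on `J`, and the sum over `b` is a
character sum modulo `M` which imposes the one on `N`, because `m + 1` is invertible modulo `M`
(`sum_psiHalf`). -/

theorem hasDerivAt_errE (x : ℝ) : HasDerivAt errE (2 * Real.exp (-Real.pi * x ^ 2)) x := by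
  have hc : Continuous fun u : ℝ => Real.exp (-Real.pi * u ^ 2) := by fun_prop
  have := intervalIntegral.integral_hasDerivAt_right (hc.intervalIntegrable 0 x)
    (hc.stronglyMeasurableAtFilter _ _) hc.continuousAt
  exact this.const_mul 2

theorem errE_zero : errE 0 = 0 := by simp [errE]

theorem errE_neg (x : ℝ) : errE (-x) = -errE x := by
  have h : ∀ x, errE (-x) + errE x = 0 := by
    have hd : ∀ x, HasDerivAt (fun x => errE (-x) + errE x) 0 x := by
      intro x
      have h1 := (hasDerivAt_errE (-x)).scomp x (hasDerivAt_neg x)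
      have h2 := h1.add (hasDerivAt_errE x)
      exact h2.congr_deriv (by rw [neg_sq, smul_eq_mul]; ring)
    intro x
    have := is_const_of_deriv_eq_zero (fun x => (hd x).differentiableAt)
      (fun x => (hd x).deriv) x 0
    simpa [errE_zero] using this
  linarith [h x]

theorem tendsto_errE_atTop : Filter.Tendsto errE Filter.atTop (nhds 1) := by
  have h := MeasureTheory.intervalIntegral_tendsto_integral_Ioi (0 : ℝ) (μ := MeasureTheory.volume)
    (f := fun u : ℝ => Real.exp (-Real.pi * u ^ 2)) (l := Filter.atTop) (b := id)
    (integrable_exp_neg_mul_sq Real.pi_pos).integrableOn Filter.tendsto_id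
  rw [integral_gaussian_Ioi, div_self Real.pi_ne_zero, Real.sqrt_one] at h
  have := h.const_mul 2
  rwa [mul_one_div_cancel two_ne_zero] at this

theorem errE_monotone : Monotone errE :=
  monotone_of_deriv_nonneg (fun x => (hasDerivAt_errE x).differentiableAt)
    (fun x => by rw [(hasDerivAt_errE x).deriv]; positivity)

theorem errE_le_one (x : ℝ) : errE x ≤ 1 := errE_monotone.ge_of_tendsto tendsto_errE_atTop x

/-- The auxiliary `g` is increasing because `(s + x)² ≥ s² + x²`; the bound compares `g 0` with its
limit at infinity. -/
theorem one_sub_errE_le {x : ℝ} (hx : 0 ≤ x) : 1 - errE x ≤ Real.exp (-Real.pi * x ^ 2) := by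
  let g : ℝ → ℝ := fun s => Real.exp (-Real.pi * x ^ 2) * errE s - errE (s + x)
  have hg : ∀ s, HasDerivAt g (Real.exp (-Real.pi * x ^ 2) * (2 * Real.exp (-Real.pi * s ^ 2))
      - 2 * Real.exp (-Real.pi * (s + x) ^ 2)) s := fun s =>
    ((hasDerivAt_errE s).const_mul _).sub ((hasDerivAt_errE (s + x)).comp_add_const s x)
  have hmono : MonotoneOn g (Set.Ici 0) := by
    refine monotoneOn_of_deriv_nonneg (convex_Ici 0)
      (fun s _ => (hg s).continuousAt.continuousWithinAt)
      (fun s _ => (hg s).differentiableAt.differentiableWithinAt) fun s hs => ?_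
    rw [interior_Ici] at hs
    rw [(hg s).deriv]
    have : Real.exp (-Real.pi * (s + x) ^ 2)
        ≤ Real.exp (-Real.pi * x ^ 2) * Real.exp (-Real.pi * s ^ 2) := by
      rw [← Real.exp_add, Real.exp_le_exp]
      nlinarith [mul_nonneg Real.pi_pos.le (mul_nonneg hx (le_of_lt hs))]
    linarith
  have hlim : Filter.Tendsto g Filter.atTop (nhds (Real.exp (-Real.pi * x ^ 2) * 1 - 1)) :=
    (tendsto_errE_atTop.const_mul _).sub
      (tendsto_errE_atTop.comp (Filter.tendsto_atTop_add_const_right _ x Filter.tendsto_id))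
  have h0 : g 0 ≤ Real.exp (-Real.pi * x ^ 2) * 1 - 1 := by
    refine ge_of_tendsto hlim ?_
    filter_upwards [Filter.eventually_ge_atTop 0] with s hs
    exact hmono (Set.mem_Ici.2 le_rfl) hs hs
  simp only [g, errE_zero, zero_add, mul_zero] at h0
  linarith

theorem neg_one_le_errE (x : ℝ) : -1 ≤ errE x := by
  have := errE_le_one (-x)
  rw [errE_neg] at this
  linarith

/-- The coefficients `sign(r + 1/2) - E((r + β) √d)` of Zwegers' function `R`. -/
noncomputable def signSubErr (d β : ℝ) (r : ℤ) : ℝ := Real.sign ((r : ℝ) + 1 / 2) - errE ((r + β) * √d)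

theorem sign_int_add_half_of_nonneg {r : ℤ} (hr : 0 ≤ r) : Real.sign ((r : ℝ) + 1 / 2) = 1 := by
  apply Real.sign_of_pos
  have : (0 : ℝ) ≤ r := by exact_mod_cast hr
  linarith

theorem sign_int_add_half_of_neg {r : ℤ} (hr : r < 0) : Real.sign ((r : ℝ) + 1 / 2) = -1 := by
  apply Real.sign_of_neg
  have : (r : ℝ) ≤ -1 := by exact_mod_cast Int.le_sub_one_of_lt hr
  linarith

/-- When `r + β` has the sign of `r + 1/2`, this is the tail bound for `E`. Otherwise `|r + β| ≤ |β|
+ 1`, and the constant makes the right side at least the trivial bound 2. -/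
theorem abs_signSubErr_le {d : ℝ} (hd : 0 < d) (β : ℝ) (r : ℤ) :
    |signSubErr d β r| ≤
      2 * Real.exp (Real.pi * d * (|β| + 1) ^ 2) * Real.exp (-(Real.pi * d * (r + β) ^ 2)) := by
  have hsq : ((r + β) * √d) ^ 2 = d * (r + β) ^ 2 := by
    rw [mul_pow, Real.sq_sqrt hd.le]; ring
  have hπ := Real.pi_pos
  have hE1 := errE_le_one ((r + β) * √d)
  have hE2 := neg_one_le_errE ((r + β) * √d)
  have hge : (1 : ℝ) ≤ 2 * Real.exp (Real.pi * d * (|β| + 1) ^ 2) := by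
    have : (1 : ℝ) ≤ Real.exp (Real.pi * d * (|β| + 1) ^ 2) := Real.one_le_exp (by positivity)
    linarith
  have good : ∀ t : ℝ, t ≤ Real.exp (-(Real.pi * d * (r + β) ^ 2)) →
      t ≤ 2 * Real.exp (Real.pi * d * (|β| + 1) ^ 2)
        * Real.exp (-(Real.pi * d * (r + β) ^ 2)) := fun t ht =>
    ht.trans (le_mul_of_one_le_left (Real.exp_pos _).le hge)
  have bad : (r + β) ^ 2 ≤ (|β| + 1) ^ 2 → (2 : ℝ) ≤ 2 * Real.exp (Real.pi * d * (|β| + 1) ^ 2)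
        * Real.exp (-(Real.pi * d * (r + β) ^ 2)) := by
    intro h
    rw [mul_assoc, ← Real.exp_add]
    have h1 : (1 : ℝ) ≤ Real.exp (Real.pi * d * (|β| + 1) ^ 2 + -(Real.pi * d * (r + β) ^ 2)) := by
      apply Real.one_le_exp
      have := mul_le_mul_of_nonneg_left h (mul_pos hπ hd).le
      linarith
    linarith
  rcases lt_or_ge r 0 with hr | hr
  · rw [signSubErr, sign_int_add_half_of_neg hr, abs_le']
    have hr' : (r : ℝ) ≤ -1 := by exact_mod_cast Int.le_sub_one_of_lt hr
    rcases le_total ((r : ℝ) + β) 0 with h | h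
    · have h1 := one_sub_errE_le (x := -((r + β) * √d))
        (by nlinarith [Real.sqrt_nonneg d])
      rw [errE_neg, neg_sq, hsq] at h1
      have h2 := good (1 + errE ((r + β) * √d)) (by rw [← mul_assoc] at *; simp only [neg_mul, mul_assoc] at *; linarith)
      constructor
      · have : 0 ≤ 2 * Real.exp (Real.pi * d * (|β| + 1) ^ 2)
          * Real.exp (-(Real.pi * d * (r + β) ^ 2)) := by positivity
        linarith
      · linarith
    · have := bad (by
        apply pow_le_pow_left₀ h
        linarith [le_abs_self β])
      constructor <;> linarith
  · rw [signSubErr, sign_int_add_half_of_nonneg hr, abs_le']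
    have hr' : (0 : ℝ) ≤ r := by exact_mod_cast hr
    rcases le_total 0 ((r : ℝ) + β) with h | h
    · have h1 := one_sub_errE_le (x := (r + β) * √d) (by positivity)
      rw [hsq] at h1
      have h2 := good (1 - errE ((r + β) * √d)) (by rw [← mul_assoc] at *; simp only [neg_mul, mul_assoc] at *; linarith)
      constructor
      · linarith
      · have : 0 ≤ 2 * Real.exp (Real.pi * d * (|β| + 1) ^ 2)
          * Real.exp (-(Real.pi * d * (r + β) ^ 2)) := by positivity
        linarith
    · have := bad (by
        rw [← neg_sq]
        apply pow_le_pow_left₀ (by linarith)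
        linarith [neg_abs_le β])
      constructor <;> linarith

/-- The `E` part depends only on `r + β`; the sign jumps exactly between `r = -1` and `r + 1 = 0`.
-/
theorem signSubErr_add_one (d β : ℝ) (r : ℤ) :
    signSubErr d (β + 1) r = signSubErr d β (r + 1) - if r = -1 then 2 else 0 := by
  have harg : ((r : ℝ) + (β + 1)) * √d = (((r + 1 : ℤ) : ℝ) + β) * √d := by push_cast; ring
  rw [signSubErr, signSubErr, harg]
  split_ifs with h
  · subst h
    rw [sign_int_add_half_of_neg (by norm_num), sign_int_add_half_of_nonneg (by norm_num)]
    ring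
  · rcases lt_or_ge r 0 with hr | hr
    · rw [sign_int_add_half_of_neg hr, sign_int_add_half_of_neg (by lia)]; ring
    · rw [sign_int_add_half_of_nonneg hr, sign_int_add_half_of_nonneg (by lia)]; ring

theorem hasDerivAt_signSubErr (d β : ℝ) (r : ℤ) :
    HasDerivAt (fun β => signSubErr d β r)
      (-(2 * √d * Real.exp (-Real.pi * ((r + β) * √d) ^ 2))) β := by
  have h1 : HasDerivAt (fun β : ℝ => ((r : ℝ) + β) * √d) (1 * √d) β :=
    ((hasDerivAt_id β).const_add (r : ℝ)).mul_const _
  have h2 := ((hasDerivAt_errE _).comp β h1).const_sub (Real.sign ((r : ℝ) + 1 / 2))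
  exact h2.congr_deriv (by ring)

/-! ### Summability of Gaussian sums -/

theorem summable_exp_neg_sq_add_linear {α : ℝ} (hα : 0 < α) (β : ℝ) :
    Summable fun n : ℤ => Real.exp (-α * n ^ 2 + β * n) := by
  have hπ := Real.pi_pos
  have := ((summable_jacobiTheta₂_term_iff (-(β / (2 * Real.pi) : ℝ) * I) ((α / Real.pi : ℝ) * I)).2
    (by simp; positivity)).norm
  refine this.congr fun n => ?_
  rw [norm_jacobiTheta₂_term]
  congr 1
  rw [← ofReal_neg, im_ofReal_mul, im_ofReal_mul, I_im]
  field_simp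
  ring

theorem summable_exp_neg_sq_add_sq {α : ℝ} (hα : 0 < α) :
    Summable fun p : ℤ × ℤ => Real.exp (-α * (p.1 ^ 2 + p.2 ^ 2)) := by
  have h := summable_exp_neg_sq_add_linear hα 0
  refine (h.mul_of_nonneg h (fun _ => (Real.exp_pos _).le) (fun _ => (Real.exp_pos _).le)).congr
    fun p => ?_
  rw [← Real.exp_add]
  congr 1
  ring

theorem summable_exp_neg_affine_sq {α α' : ℝ} (hα : 0 < α) (hα' : 0 < α') (x x₀ y w : ℝ)
    (hy : y ≠ 0) :
    Summable fun p : ℤ × ℤ =>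
      Real.exp (-(α * (p.2 + x * p.1 + x₀) ^ 2 + α' * (y * p.1 + w) ^ 2)) := by
  set μ := min α α'
  have hμ : 0 < μ := lt_min hα hα'
  -- The constants of `|p|² ≤ C₁ (A² + B²) + C₂`, obtained by solving the affine forms `A`, `B`
  -- below for `p`.
  set C₁ : ℝ := 3 + (1 + 3 * x ^ 2) * (2 / y ^ 2)
  set C₂ : ℝ := 3 * x₀ ^ 2 + (1 + 3 * x ^ 2) * (2 * w ^ 2 / y ^ 2)
  have hC₁ : 0 < C₁ := by positivity
  refine Summable.of_nonneg_of_le (fun _ => (Real.exp_pos _).le) (fun p => ?_)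
    ((summable_exp_neg_sq_add_sq (div_pos hμ hC₁)).mul_left (Real.exp (μ / C₁ * C₂)))
  rw [← Real.exp_add, Real.exp_le_exp]
  set A := (p.2 : ℝ) + x * p.1 + x₀ with hA
  set B := y * (p.1 : ℝ) + w with hB
  have h1 : (p.1 : ℝ) ^ 2 ≤ 2 / y ^ 2 * B ^ 2 + 2 * w ^ 2 / y ^ 2 := by
    have : (p.1 : ℝ) = (B - w) / y := by rw [hB]; field_simp; ring
    have h' : (p.1 : ℝ) ^ 2 = (B - w) ^ 2 / y ^ 2 := by rw [this, div_pow]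
    have h'' : 2 / y ^ 2 * B ^ 2 + 2 * w ^ 2 / y ^ 2 = (2 * B ^ 2 + 2 * w ^ 2) / y ^ 2 := by ring
    rw [h', h'']
    gcongr
    nlinarith [sq_nonneg (B + w)]
  have h2 : (p.2 : ℝ) ^ 2 ≤ 3 * A ^ 2 + 3 * x ^ 2 * p.1 ^ 2 + 3 * x₀ ^ 2 := by
    have : (p.2 : ℝ) = A - x * p.1 - x₀ := by rw [hA]; ring
    rw [this]
    nlinarith [sq_nonneg (A + x * p.1), sq_nonneg (A + x₀), sq_nonneg (x * p.1 - x₀)]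
  have h3 : (p.1 : ℝ) ^ 2 + p.2 ^ 2 ≤ C₁ * (A ^ 2 + B ^ 2) + C₂ := by
    have h4 := mul_le_mul_of_nonneg_left h1 (by positivity : 0 ≤ 1 + 3 * x ^ 2)
    have h5 : 0 ≤ 3 * B ^ 2 + (1 + 3 * x ^ 2) * (2 / y ^ 2) * A ^ 2 := by positivity
    simp only [C₁, C₂]
    linarith
  have h6 : μ / C₁ * ((p.1 : ℝ) ^ 2 + p.2 ^ 2) ≤ μ * (A ^ 2 + B ^ 2) + μ / C₁ * C₂ := by
    calc _ ≤ μ / C₁ * (C₁ * (A ^ 2 + B ^ 2) + C₂) := by gcongr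
      _ = _ := by field_simp
  have h7 : μ * A ^ 2 ≤ α * A ^ 2 := by gcongr; exact min_le_left _ _
  have h8 : μ * B ^ 2 ≤ α' * B ^ 2 := by gcongr; exact min_le_right _ _
  linarith

/-! ### The one-dimensional identity -/

theorem tsum_gaussian_poisson {d : ℝ} (hd : 0 < d) (β : ℝ) (ζ : ℂ) :
    ∑' a : ℤ, cexp (-(pi / d : ℝ) * (ζ + a) ^ 2 - 2 * pi * I * β * (ζ + a)) =
      √d * ∑' r : ℤ, cexp (-(pi * d : ℝ) * (r + β) ^ 2 + 2 * pi * I * r * ζ) := by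
  have hd' : (d : ℂ) ≠ 0 := by exact_mod_cast hd.ne'
  have h := Complex.tsum_exp_neg_quadratic (a := ((d⁻¹ : ℝ) : ℂ))
    (by rw [ofReal_re]; positivity) (-ζ / d - I * β)
  have hs : (1 : ℂ) / ((d⁻¹ : ℝ) : ℂ) ^ (1 / 2 : ℂ) = √d := by
    have : ((1 / 2 : ℝ) : ℂ) = 1 / 2 := by norm_num
    rw [← this, ← Complex.ofReal_cpow (by positivity), ← Real.sqrt_eq_rpow, Real.sqrt_inv]
    push_cast
    simp
  rw [hs] at h
  have hL : ∀ a : ℤ, cexp (-(pi / d : ℝ) * (ζ + a) ^ 2 - 2 * pi * I * β * (ζ + a)) =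
      cexp (-(pi / d : ℝ) * ζ ^ 2 - 2 * pi * I * β * ζ) *
        cexp (-pi * ((d⁻¹ : ℝ) : ℂ) * a ^ 2 + 2 * pi * (-ζ / d - I * β) * a) := by
    intro a
    rw [← Complex.exp_add]
    congr 1
    push_cast
    field_simp
    ring
  simp_rw [hL]
  rw [tsum_mul_left, h, mul_left_comm, ← tsum_mul_left]
  congr 2
  funext r
  rw [← Complex.exp_add]
  congr 1
  push_cast
  field_simp
  ring_nf
  simp only [I_sq, I_pow_three, I_pow_four]
  ring

/-- Summability of the Gaussian forces `‖s i‖ ≥ 1` for all but finitely many `i`, so dividing by `s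
i` costs nothing. -/
theorem summable_div_of_summable_gaussian {ι : Type*} {α : ℝ} (hα : 0 < α) {f s : ι → ℂ}
    (hs : Summable fun i => Real.exp (-α * ‖s i‖ ^ 2)) (hf : Summable fun i => ‖f i‖) :
    Summable fun i => f i / s i := by
  refine Summable.of_norm_bounded_eventually hf ?_
  have h1 : ∀ᶠ i in Filter.cofinite, Real.exp (-α * ‖s i‖ ^ 2) < Real.exp (-α) :=
    hs.tendsto_cofinite_zero.eventually_lt_const (Real.exp_pos _)
  filter_upwards [h1] with i hi
  rw [Real.exp_lt_exp] at hi
  have h2 : 1 ≤ ‖s i‖ := by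
    by_contra! h
    have : ‖s i‖ ^ 2 ≤ 1 := pow_le_one₀ (norm_nonneg _) h.le
    nlinarith
  rw [norm_div]
  exact div_le_self (norm_nonneg _) h2

theorem hasDerivAt_tsum_of_local_bound {ι : Type*} {g g' : ι → ℝ → ℂ}
    (hg : ∀ i y, HasDerivAt (g i) (g' i y) y) (h0 : Summable fun i => g i 0)
    (hb : ∀ R : ℝ, 0 < R → ∃ u : ι → ℝ, Summable u ∧ ∀ i y, |y| < R → ‖g' i y‖ ≤ u i) (y : ℝ) :
    HasDerivAt (fun y => ∑' i, g i y) (∑' i, g' i y) y := by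
  have hR : 0 < |y| + 1 := by positivity
  obtain ⟨u, hu, hbd⟩ := hb _ hR
  refine hasDerivAt_tsum_of_isPreconnected hu (Metric.isOpen_ball (x := (0 : ℝ)) (ε := |y| + 1))
    (convex_ball _ _).isPreconnected (fun i z _ => hg i z) (fun i z hz => hbd i z ?_)
    (Metric.mem_ball_self hR) h0 ?_
  · simpa using hz
  · simp

theorem norm_cexp_gaussian (d β : ℝ) (s : ℂ) :
    ‖cexp (-(pi / d : ℝ) * s ^ 2 - 2 * pi * I * β * s)‖ =
      Real.exp (-(pi / d) * (s.re ^ 2 - s.im ^ 2) + 2 * pi * β * s.im) := by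
  rw [norm_exp]
  congr 1
  simp [pow_two]

theorem norm_cexp_two_pi_int_mul (r : ℤ) (ζ : ℂ) :
    ‖cexp (2 * pi * I * r * ζ)‖ = Real.exp (-2 * pi * ζ.im * r) := by
  rw [norm_exp]
  congr 1
  simp
  ring

theorem summable_gaussian_div {d : ℝ} (hd : 0 < d) (β : ℝ) (ζ : ℂ) :
    Summable fun a : ℤ =>
      cexp (-(pi / d : ℝ) * (ζ + a) ^ 2 - 2 * pi * I * β * (ζ + a)) / (ζ + a) := by
  have hc : 0 < pi / d := div_pos Real.pi_pos hd
  have key := summable_exp_neg_sq_add_linear hc (-(pi / d) * (2 * ζ.re))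
  refine summable_div_of_summable_gaussian hc ?_ ?_
  · refine (key.mul_left (Real.exp (-(pi / d) * (ζ.re ^ 2 + ζ.im ^ 2)))).congr fun a => ?_
    rw [← Real.exp_add, ← normSq_eq_norm_sq, normSq_apply]
    congr 1
    simp
    ring
  · refine (key.mul_left (Real.exp (-(pi / d) * (ζ.re ^ 2 - ζ.im ^ 2) + 2 * pi * β * ζ.im))).congr
      fun a => ?_
    rw [norm_cexp_gaussian, ← Real.exp_add]
    congr 1
    simp
    ring

theorem summable_signSubErr_mul {d : ℝ} (hd : 0 < d) (β : ℝ) (ζ : ℂ) :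
    Summable fun r : ℤ => (signSubErr d β r : ℂ) * cexp (2 * pi * I * r * ζ) := by
  have hc : 0 < pi * d := mul_pos Real.pi_pos hd
  have key := summable_exp_neg_sq_add_linear hc (-(pi * d) * (2 * β) - 2 * pi * ζ.im)
  refine Summable.of_norm_bounded (key.mul_left (2 * Real.exp (pi * d * (|β| + 1) ^ 2)
    * Real.exp (-(pi * d * β ^ 2)))) fun r => ?_
  rw [norm_mul, norm_cexp_two_pi_int_mul, norm_real, Real.norm_eq_abs]
  calc _ ≤ _ := mul_le_mul_of_nonneg_right (abs_signSubErr_le hd β r) (Real.exp_pos _).le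
    _ = _ := by
      rw [mul_assoc, mul_assoc (2 * _), ← Real.exp_add, ← Real.exp_add]
      congr 2
      ring

theorem hasDerivAt_tsum_gaussian_div {d : ℝ} (hd : 0 < d) (ζ : ℂ) (hζ : ∀ n : ℤ, ζ + n ≠ 0)
    (β : ℝ) :
    HasDerivAt (fun β : ℝ => ∑' a : ℤ,
        cexp (-(pi / d : ℝ) * (ζ + a) ^ 2 - 2 * pi * I * β * (ζ + a)) / (ζ + a))
      (∑' a : ℤ, -2 * pi * I * cexp (-(pi / d : ℝ) * (ζ + a) ^ 2 - 2 * pi * I * β * (ζ + a))) β := by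
  have hc : 0 < pi / d := div_pos Real.pi_pos hd
  refine hasDerivAt_tsum_of_local_bound (g := fun a β =>
    cexp (-(pi / d : ℝ) * (ζ + (a : ℤ)) ^ 2 - 2 * pi * I * (β : ℝ) * (ζ + a)) / (ζ + a))
    (g' := fun a β =>
      -2 * pi * I * cexp (-(pi / d : ℝ) * (ζ + a) ^ 2 - 2 * pi * I * β * (ζ + a)))
    (fun a β => ?_) (summable_gaussian_div hd 0 ζ) (fun R hR => ?_) β
  · have h1 : HasDerivAt (fun b : ℝ => (b : ℂ)) 1 β := ofRealCLM.hasDerivAt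
    have h2 := (((h1.const_mul (2 * pi * I)).mul_const (ζ + a)).const_sub
      (-(pi / d : ℝ) * (ζ + a) ^ 2)).cexp.div_const (ζ + a)
    refine h2.congr_deriv ?_
    have := hζ a
    field_simp
  · refine ⟨_, (summable_exp_neg_sq_add_linear hc (-(pi / d) * (2 * ζ.re))).mul_left
      (2 * pi * Real.exp (-(pi / d) * (ζ.re ^ 2 - ζ.im ^ 2) + 2 * pi * (R * |ζ.im|))),
      fun a b hb => ?_⟩
    have h2 : ‖(-2 * pi * I : ℂ)‖ = 2 * pi := by
      simp [abs_of_pos Real.pi_pos]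
    rw [norm_mul, norm_cexp_gaussian, h2, mul_assoc (2 * pi) (Real.exp _), ← Real.exp_add]
    refine mul_le_mul_of_nonneg_left (Real.exp_le_exp.2 ?_) Real.two_pi_pos.le
    have h3 : b * ζ.im ≤ R * |ζ.im| := (le_abs_self _).trans (by rw [abs_mul]; gcongr)
    have h4 := mul_le_mul_of_nonneg_left h3 Real.two_pi_pos.le
    simp only [add_re, intCast_re, add_im, intCast_im, add_zero]
    linarith

theorem hasDerivAt_tsum_signSubErr {d : ℝ} (hd : 0 < d) (ζ : ℂ) (β : ℝ) :
    HasDerivAt (fun β : ℝ => ∑' r : ℤ, (signSubErr d β r : ℂ) * cexp (2 * pi * I * r * ζ))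
      (∑' r : ℤ, -2 * √d * cexp (-(pi * d : ℝ) * (r + β) ^ 2 + 2 * pi * I * r * ζ)) β := by
  have hc : 0 < pi * d / 2 := by have := Real.pi_pos; positivity
  refine hasDerivAt_tsum_of_local_bound (g := fun r β =>
    (signSubErr d β r : ℂ) * cexp (2 * pi * I * r * ζ))
    (g' := fun r β => -2 * √d * cexp (-(pi * d : ℝ) * (r + β) ^ 2 + 2 * pi * I * r * ζ))
    (fun r β => ?_) (summable_signSubErr_mul hd 0 ζ) (fun R hR => ?_) β
  · refine ((hasDerivAt_signSubErr d β r).ofReal_comp.mul_const _).congr_deriv ?_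
    rw [Complex.exp_add, mul_pow, Real.sq_sqrt hd.le]
    push_cast
    ring_nf
  · refine ⟨_, (summable_exp_neg_sq_add_linear hc (-2 * pi * ζ.im)).mul_left
      (2 * √d * Real.exp (pi * d * R ^ 2)), fun r b hb => ?_⟩
    have h1 : (-(pi * d : ℝ) : ℂ) * ((r : ℂ) + b) ^ 2 = ((-(pi * d) * (r + b) ^ 2 : ℝ) : ℂ) := by
      push_cast; ring
    have h2 : ‖(-2 * √d : ℂ)‖ = 2 * √d := by
      simp [abs_of_nonneg (Real.sqrt_nonneg d)]
    rw [Complex.exp_add, h1, norm_mul, norm_mul (cexp _), norm_cexp_two_pi_int_mul, norm_exp, ofReal_re, h2,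
      ← Real.exp_add, mul_assoc (2 * √d), ← Real.exp_add]
    refine mul_le_mul_of_nonneg_left (Real.exp_le_exp.2 ?_) (by positivity)
    have h3 : b ^ 2 ≤ R ^ 2 := by rw [← sq_abs b]; gcongr
    have h4 := mul_le_mul_of_nonneg_left (by nlinarith [sq_nonneg ((r : ℝ) + 2 * b)] :
      (r : ℝ) ^ 2 / 2 - R ^ 2 ≤ (r + b) ^ 2) (mul_pos Real.pi_pos hd).le
    linarith

theorem tsum_gaussian_div_add_one (d β : ℝ) (ζ : ℂ) :
    ∑' a : ℤ, cexp (-(pi / d : ℝ) * (ζ + a) ^ 2 - 2 * pi * I * (β + 1 : ℝ) * (ζ + a)) / (ζ + a) =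
      cexp (-(2 * pi * I * ζ)) *
        ∑' a : ℤ, cexp (-(pi / d : ℝ) * (ζ + a) ^ 2 - 2 * pi * I * β * (ζ + a)) / (ζ + a) := by
  rw [← tsum_mul_left]
  congr 1
  funext a
  rw [← mul_div_assoc, ← Complex.exp_add]
  congr 1
  rw [Complex.exp_eq_exp_iff_exists_int]
  refine ⟨-a, ?_⟩
  push_cast
  ring

theorem tsum_signSubErr_add_one {d : ℝ} (hd : 0 < d) (β : ℝ) (ζ : ℂ) :
    ∑' r : ℤ, (signSubErr d (β + 1) r : ℂ) * cexp (2 * pi * I * r * ζ) =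
      cexp (-(2 * pi * I * ζ)) *
        (∑' r : ℤ, (signSubErr d β r : ℂ) * cexp (2 * pi * I * r * ζ) - 2) := by
  have hS := summable_signSubErr_mul hd β ζ
  have h1 : ∀ r : ℤ, (signSubErr d (β + 1) r : ℂ) * cexp (2 * pi * I * r * ζ) =
      cexp (-(2 * pi * I * ζ)) *
        ((signSubErr d β (Equiv.addRight 1 r) : ℂ)
            * cexp (2 * pi * I * (Equiv.addRight (1 : ℤ) r : ℤ) * ζ)
          - if r = -1 then 2 else 0) := by
    intro r
    have h2 : cexp (2 * pi * I * r * ζ) =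
        cexp (-(2 * pi * I * ζ)) * cexp (2 * pi * I * (r + 1 : ℤ) * ζ) := by
      rw [← Complex.exp_add]
      congr 1
      push_cast
      ring
    rw [signSubErr_add_one, Equiv.coe_addRight]
    split_ifs with h
    · subst h
      rw [h2]
      simp
      ring
    · rw [h2]
      push_cast
      ring
  simp_rw [h1]
  rw [tsum_mul_left]
  congr 1
  have hS' : Summable fun r : ℤ => (signSubErr d β (Equiv.addRight 1 r) : ℂ)
      * cexp (2 * pi * I * (Equiv.addRight (1 : ℤ) r : ℤ) * ζ) := (Equiv.addRight (1 : ℤ)).summable_iff.2 hS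
  rw [Summable.tsum_sub hS' (summable_of_ne_finset_zero (s := {-1}) (by simp)),
    tsum_ite_eq]
  congr 1
  exact (Equiv.addRight (1 : ℤ)).tsum_eq (fun r : ℤ =>
    (signSubErr d β r : ℂ) * cexp (2 * pi * I * r * ζ))

theorem cexp_two_pi_ne_one {ζ : ℂ} (hζ : ∀ n : ℤ, ζ + n ≠ 0) : cexp (2 * pi * I * ζ) ≠ 1 := by
  intro h
  obtain ⟨n, hn⟩ := Complex.exp_eq_one_iff.1 h
  apply hζ (-n)
  have : (2 * pi * I : ℂ) ≠ 0 := Complex.two_pi_I_ne_zero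
  have h2 : 2 * pi * I * (ζ - n) = 0 := by rw [mul_sub, hn]; ring
  have h3 := (mul_eq_zero.1 h2).resolve_left this
  push_cast
  rw [← sub_eq_add_neg]
  exact h3

/-- A partial fraction identity: a Gaussian-damped sum of simple poles is a geometric series
completed by error functions. -/
theorem tsum_gaussian_div_eq {d : ℝ} (hd : 0 < d) (β : ℝ) (ζ : ℂ) (hζ : ∀ n : ℤ, ζ + n ≠ 0) :
    ∑' a : ℤ, cexp (-(pi / d : ℝ) * (ζ + a) ^ 2 - 2 * pi * I * β * (ζ + a)) / (ζ + a) =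
      -2 * pi * I / (1 - cexp (2 * pi * I * ζ)) +
        pi * I * ∑' r : ℤ, (signSubErr d β r : ℂ) * cexp (2 * pi * I * r * ζ) := by
  set F : ℝ → ℂ := fun β => ∑' a : ℤ,
    cexp (-(pi / d : ℝ) * (ζ + a) ^ 2 - 2 * pi * I * β * (ζ + a)) / (ζ + a) with hF
  set G : ℝ → ℂ := fun β => ∑' r : ℤ, (signSubErr d β r : ℂ) * cexp (2 * pi * I * r * ζ) with hG
  set D : ℝ → ℂ := fun β => F β - pi * I * G β with hD
  -- Differentiating in `β` cancels the poles on one side and turns `E` into a Gaussian on the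
  -- other; Poisson summation equates the two.
  have hder : ∀ β, HasDerivAt D 0 β := by
    intro β
    refine ((hasDerivAt_tsum_gaussian_div hd ζ hζ β).sub
      ((hasDerivAt_tsum_signSubErr hd ζ β).const_mul (pi * I))).congr_deriv ?_
    rw [tsum_mul_left, tsum_mul_left, tsum_gaussian_poisson hd]
    ring
  -- The constant is pinned down by quasi-periodicity: `β ↦ β + 1` gives `D = exp(-2πiζ) (D + 2πi)`.
  have hconst : D (β + 1) = D β := is_const_of_deriv_eq_zero
    (fun x => (hder x).differentiableAt) (fun x => (hder x).deriv) _ _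
  have hF1 : F (β + 1) = cexp (-(2 * pi * I * ζ)) * F β := tsum_gaussian_div_add_one d β ζ
  have hG1 : G (β + 1) = cexp (-(2 * pi * I * ζ)) * (G β - 2) := tsum_signSubErr_add_one hd β ζ
  have hne : 1 - cexp (2 * pi * I * ζ) ≠ 0 := sub_ne_zero.2 (cexp_two_pi_ne_one hζ).symm
  have hinv : cexp (2 * pi * I * ζ) * cexp (-(2 * pi * I * ζ)) = 1 := by
    rw [← Complex.exp_add, add_neg_cancel, Complex.exp_zero]
  simp only [hD, hF1, hG1] at hconst
  change F β = _ + pi * I * G β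
  rw [← sub_eq_iff_eq_add, eq_div_iff hne]
  linear_combination cexp (2 * pi * I * ζ) * hconst
    - (F β - pi * I * G β + 2 * pi * I) * hinv

/-! ### The lattice sum -/

/-- The summand, at the lattice point `p.1 τ + p.2`, of the lattice sum that represents half of
the modified function `modPhi`. -/
noncomputable def latTerm (K : ℕ) (τ z₁ z₂ : ℂ) (p : ℤ × ℤ) : ℂ :=
  cexp (2 * pi * I * K * p.1 * z₂)
    * cexp (-(pi * K / τ.im : ℝ)
        * ((z₁ + p.1 * τ + p.2) * (conj (z₁ + p.1 * τ + p.2) + (z₂ - conj z₂))))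
    / (z₁ + p.1 * τ + p.2)

/-- The Gaussian-damped lattice sum over `ℤ τ + ℤ`. -/
noncomputable def latSum (K : ℕ) (τ z₁ z₂ : ℂ) : ℂ := ∑' p, latTerm K τ z₁ z₂ p

/-- The factor `exp(2πiκ p.1 z₂)` cancels the growth of the cross term, so each numerator has
absolute value a constant times `exp(-(πκ / Im τ) |ω|²)`. A real `κ` covers both `K` and `K / M`. -/
theorem summable_lattice_gaussian {κ : ℝ} (hκ : 0 < κ) {τ : ℂ} (hτ : 0 < τ.im) (z₁ z₂ : ℂ) :
    Summable fun p : ℤ × ℤ => cexp (2 * pi * I * κ * p.1 * z₂)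
      * cexp (-(pi * κ / τ.im : ℝ)
        * ((z₁ + p.1 * τ + p.2) * (conj (z₁ + p.1 * τ + p.2) + (z₂ - conj z₂))))
      / (z₁ + p.1 * τ + p.2) := by
  have hc : 0 < pi * κ / τ.im := div_pos (mul_pos Real.pi_pos hκ) hτ
  have key : Summable fun p : ℤ × ℤ =>
      Real.exp (-(pi * κ / τ.im) * ‖z₁ + p.1 * τ + p.2‖ ^ 2) := by
    refine (summable_exp_neg_affine_sq hc hc τ.re z₁.re τ.im z₁.im hτ.ne').congr fun p => ?_
    rw [← normSq_eq_norm_sq, normSq_apply]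
    congr 1
    simp
    ring
  refine summable_div_of_summable_gaussian hc key
    ((key.mul_left (Real.exp (pi * κ / τ.im * (2 * z₁.im * z₂.im)))).congr fun p => ?_)
  rw [← Complex.exp_add, norm_exp, ← Real.exp_add, ← normSq_eq_norm_sq, normSq_apply]
  congr 1
  simp
  field_simp
  ring

theorem summable_latTerm {K : ℕ} (hK : 0 < K) {τ : ℂ} (hτ : 0 < τ.im) (z₁ z₂ : ℂ) :
    Summable (latTerm K τ z₁ z₂) :=
  summable_lattice_gaussian (Nat.cast_pos.2 hK) hτ z₁ z₂

theorem latTerm_eq {K : ℕ} {τ : ℂ} (hτ : 0 < τ.im) (z₁ z₂ : ℂ) (j a : ℤ) :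
    latTerm K τ z₁ z₂ (j, a) =
      cexp (2 * pi * I * j * K * (z₁ + z₂)) * cexp (2 * pi * I * τ * (j ^ 2 * K))
        * (cexp (-(pi / (τ.im / K) : ℝ) * ((z₁ + j * τ) + a) ^ 2
            - 2 * pi * I * (K * (z₂.im - z₁.im) / τ.im : ℝ) * ((z₁ + j * τ) + a))
          / ((z₁ + j * τ) + a)) := by
  rw [latTerm, mul_div_assoc', ← Complex.exp_add, ← Complex.exp_add, ← Complex.exp_add]
  congr 1
  rw [Complex.exp_eq_exp_iff_exists_int]
  -- Replacing `conj ω` by `ω - 2i Im ω` leaves only the trivial phase `exp(2πi K j a)`.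
  refine ⟨K * j * a, ?_⟩
  have h1 : conj (z₁ + j * τ + a) = z₁ + j * τ + a - 2 * I * (z₁.im + j * τ.im : ℝ) := by
    exact Complex.ext (by simp) (by simp; ring)
  have h2 : z₂ - conj z₂ = 2 * I * z₂.im := by
    exact Complex.ext (by simp) (by simp; ring)
  have hy : (τ.im : ℂ) ≠ 0 := by exact_mod_cast hτ.ne'
  simp only [h1, h2]
  push_cast
  field_simp
  ring

theorem tsum_latTerm_row {K : ℕ} (hK : 0 < K) {τ : ℂ} (hτ : 0 < τ.im) (z₁ z₂ : ℂ) (j : ℤ)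
    (h : ∀ n : ℤ, z₁ + j * τ + n ≠ 0) :
    I / (2 * pi) * ∑' a : ℤ, latTerm K τ z₁ z₂ (j, a) =
      cexp (2 * pi * I * j * K * (z₁ + z₂)) * cexp (2 * pi * I * τ * (j ^ 2 * K))
        * (1 / (1 - cexp (2 * pi * I * (z₁ + j * τ)))
          - 1 / 2 * ∑' r : ℤ, (signSubErr (τ.im / K) (K * (z₂.im - z₁.im) / τ.im) r : ℂ)
              * cexp (2 * pi * I * r * (z₁ + j * τ))) := by
  have hK' : (0 : ℝ) < K := by exact_mod_cast hK
  simp_rw [latTerm_eq hτ]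
  rw [tsum_mul_left, tsum_gaussian_div_eq (div_pos hτ hK') _ _ h]
  have hne : 1 - cexp (2 * pi * I * (z₁ + j * τ)) ≠ 0 :=
    sub_ne_zero.2 (cexp_two_pi_ne_one h).symm
  have hπ : (pi : ℂ) ≠ 0 := by exact_mod_cast Real.pi_ne_zero
  field_simp
  ring_nf
  rw [I_sq]
  ring

theorem tsum_gaussian_div_neg (d β : ℝ) (ζ : ℂ) :
    ∑' a : ℤ, cexp (-(pi / d : ℝ) * (ζ + a) ^ 2 - 2 * pi * I * (-β : ℝ) * (ζ + a)) / (ζ + a) =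
      -∑' a : ℤ, cexp (-(pi / d : ℝ) * (-ζ + a) ^ 2 - 2 * pi * I * β * (-ζ + a)) / (-ζ + a) := by
  rw [← (Equiv.neg ℤ).tsum_eq, ← tsum_neg]
  congr 1
  funext a
  have : ζ + ((-a : ℤ) : ℂ) = -(-ζ + a) := by push_cast; ring
  rw [Equiv.neg_apply, this, div_neg]
  congr 3
  push_cast
  ring

/-- The substitution `a ↦ -a` flips the sign of `β`. It is used for the `z₁` half, so that both
halves involve `zwegersR` at the same point `(z₁ - z₂) / 2`. -/
theorem tsum_latTerm_row_reflected {K : ℕ} (hK : 0 < K) {τ : ℂ} (hτ : 0 < τ.im) (z₁ z₂ : ℂ) (j : ℤ)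
    (h : ∀ n : ℤ, z₁ + j * τ + n ≠ 0) :
    I / (2 * pi) * ∑' a : ℤ, latTerm K τ z₁ z₂ (j, a) =
      cexp (2 * pi * I * j * K * (z₁ + z₂)) * cexp (2 * pi * I * τ * (j ^ 2 * K))
        * (1 / (1 - cexp (2 * pi * I * (z₁ + j * τ))) - 1
          + 1 / 2 * ∑' r : ℤ, (signSubErr (τ.im / K) (K * (z₁.im - z₂.im) / τ.im) r : ℂ)
              * cexp (-(2 * pi * I * r * (z₁ + j * τ)))) := by
  have hK' : (0 : ℝ) < K := by exact_mod_cast hK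
  have hβ : K * (z₂.im - z₁.im) / τ.im = -(K * (z₁.im - z₂.im) / τ.im) := by ring
  have h' : ∀ n : ℤ, -(z₁ + j * τ) + n ≠ 0 := by
    intro n hn
    apply h (-n)
    push_cast
    linear_combination -hn
  simp_rw [latTerm_eq hτ, hβ]
  rw [tsum_mul_left, tsum_gaussian_div_neg, tsum_gaussian_div_eq (div_pos hτ hK') _ _ h']
  have hne : 1 - cexp (2 * pi * I * (z₁ + j * τ)) ≠ 0 :=
    sub_ne_zero.2 (cexp_two_pi_ne_one h).symm
  have hπ : (pi : ℂ) ≠ 0 := by exact_mod_cast Real.pi_ne_zero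
  have he : ∀ r : ℤ, cexp (2 * pi * I * r * -(z₁ + j * τ))
      = cexp (-(2 * pi * I * r * (z₁ + j * τ))) := fun r => by rw [mul_neg]
  have he1 : 1 / (1 - cexp (2 * pi * I * -(z₁ + j * τ)))
      = 1 - 1 / (1 - cexp (2 * pi * I * (z₁ + j * τ))) := by
    rw [mul_neg, Complex.exp_neg]
    have := Complex.exp_ne_zero (2 * pi * I * (z₁ + j * τ))
    have h2 : cexp (2 * pi * I * (z₁ + j * τ)) - 1 ≠ 0 := by
      rw [← neg_sub]; exact neg_ne_zero.2 hne
    field_simp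
    ring
  simp_rw [he]
  rw [div_eq_mul_one_div (-2 * (pi : ℂ) * I), he1]
  field_simp
  ring_nf
  rw [I_sq]
  ring

/-! ### The theta decomposition of the correction -/

/-- The summands of `zwegersR`. -/
noncomputable def zwegersTerm (K : ℕ) (τ v : ℂ) (r : ℤ) : ℂ :=
  signSubErr (τ.im / K) (2 * K * (v.im / τ.im)) r
    * cexp (-(pi * I * (r : ℂ) ^ 2 / (2 * K)) * τ - 2 * pi * I * r * v)

/-- The summands of `thetaJK`. -/
noncomputable def thetaTerm (K : ℕ) (τ w : ℂ) (r n : ℤ) : ℂ :=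
  cexp (2 * pi * I * τ * (K * (n + r / (2 * K)) ^ 2) + 2 * pi * I * K * (n + r / (2 * K)) * w)

/-- The growth of `q^(-r²/(4K))` consumes only half of the Gaussian decay of the coefficient in `r`,
hence the rate `π (Im τ / K) / 2` that remains. -/
theorem summable_zwegersTerm_mul_thetaTerm {K : ℕ} (hK : 0 < K) {τ : ℂ} (hτ : 0 < τ.im) (v w : ℂ)
    {σ : ℤ} (hσ : σ ^ 2 = 1) :
    Summable fun p : ℤ × ℤ => zwegersTerm K τ v p.1 * thetaTerm K τ w (σ * p.1) p.2 := by
  have hK' : (0 : ℝ) < K := by exact_mod_cast hK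
  have hd := div_pos hτ hK'
  have hπ := Real.pi_pos
  set β : ℝ := 2 * K * (v.im / τ.im) with hβ
  have key := summable_exp_neg_affine_sq (α := 2 * pi * τ.im * K) (α' := pi * (τ.im / K) / 2)
    (by positivity) (by positivity) (σ / (2 * K)) (w.im / (2 * τ.im)) 1 β one_ne_zero
  refine Summable.of_norm_bounded (key.mul_left (2 * Real.exp (pi * (τ.im / K) * (|β| + 1) ^ 2)
    * Real.exp (-(pi * (τ.im / K) * β ^ 2 / 2) + pi * K * w.im ^ 2 / (2 * τ.im)))) fun p => ?_
  rw [zwegersTerm, thetaTerm, mul_assoc, ← Complex.exp_add, norm_mul, norm_real, Real.norm_eq_abs,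
    norm_exp]
  calc _ ≤ _ := mul_le_mul_of_nonneg_right (abs_signSubErr_le hd β p.1) (Real.exp_pos _).le
    _ = _ := by
      rw [mul_assoc, mul_assoc (2 * Real.exp _), ← Real.exp_add, ← Real.exp_add]
      congr 2
      have h1 : (-(pi * I * (p.1 : ℂ) ^ 2 / (2 * K)) * τ - 2 * pi * I * p.1 * v
          + (2 * pi * I * τ * (K * (p.2 + (σ * p.1 : ℤ) / (2 * K)) ^ 2)
            + 2 * pi * I * K * (p.2 + (σ * p.1 : ℤ) / (2 * K)) * w)) =
          I * (((-(pi * (p.1 : ℝ) ^ 2 / (2 * K)) + 2 * pi * K * (p.2 + (σ * p.1) / (2 * K)) ^ 2 : ℝ)) * τ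
            - ((2 * pi * p.1 : ℝ)) * v + ((2 * pi * K * (p.2 + (σ * p.1) / (2 * K)) : ℝ)) * w) := by
        push_cast
        ring
      rw [h1, I_mul_re, add_im, sub_im, im_ofReal_mul, im_ofReal_mul, im_ofReal_mul]
      have hv : v.im = β * τ.im / (2 * K) := by rw [hβ]; field_simp
      have hσ' : (σ : ℝ) ^ 2 = 1 := by exact_mod_cast hσ
      rw [hv]
      field_simp
      ring

theorem tsum_eq_sum_range_tsum {N : ℕ} (hN : 0 < N) {f : ℤ → ℂ} (hf : Summable f) :
    ∑' r, f r = ∑ j ∈ Finset.range N, ∑' l : ℤ, f (j + N * l) := by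
  have : NeZero N := ⟨hN.ne'⟩
  have h1 := (Equiv.prodComm _ _).trans (Int.divModEquiv N).symm |>.tsum_eq f
  have hs := ((Equiv.prodComm _ _).trans (Int.divModEquiv N).symm).summable_iff.2 hf
  rw [← h1, Summable.tsum_prod (f := fun p => f (((Equiv.prodComm (Fin N) ℤ).trans
    (Int.divModEquiv N).symm) p)) hs, tsum_fintype, Finset.sum_range]
  refine Finset.sum_congr rfl fun j _ => tsum_congr fun l => ?_
  congr 1
  change l * (N : ℤ) + (j : ℕ) = _
  ring

theorem thetaJK_add_mul {K : ℕ} (hK : 0 < K) (τ w : ℂ) (j l : ℤ) :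
    thetaJK (j + 2 * K * l) K τ w = thetaJK j K τ w := by
  have hK' : (K : ℂ) ≠ 0 := by exact_mod_cast hK.ne'
  symm
  rw [thetaJK, thetaJK, ← (Equiv.addRight l).tsum_eq]
  refine tsum_congr fun n => ?_
  have : (n : ℂ) + ((j + 2 * K * l : ℤ) : ℂ) / (2 * K)
      = ((Equiv.addRight l n : ℤ) : ℂ) + (j : ℂ) / (2 * K) := by
    rw [Equiv.coe_addRight]
    push_cast
    field_simp
    ring
  rw [this]

/-- As `thetaJK` depends on its index only modulo `2K`, the residue `j` and the summation variable
of `zwegersR` merge into one integer `r`. The sign `σ` treats the indices `j` and `-j` together. -/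
theorem sum_zwegersR_mul_thetaJK {K : ℕ} (hK : 0 < K) {τ : ℂ} (hτ : 0 < τ.im) (v w : ℂ) {σ : ℤ}
    (hσ : σ ^ 2 = 1) :
    ∑ j ∈ Finset.range (2 * K), zwegersR K j τ v * thetaJK (σ * j) K τ w =
      ∑' p : ℤ × ℤ, zwegersTerm K τ v p.1 * thetaTerm K τ w (σ * p.1) p.2 := by
  have hs := summable_zwegersTerm_mul_thetaTerm hK hτ v w hσ
  have hr : ∀ r : ℤ, ∑' n : ℤ, zwegersTerm K τ v r * thetaTerm K τ w (σ * r) n =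
      zwegersTerm K τ v r * thetaJK (σ * r) K τ w := fun r => tsum_mul_left
  have hs1 : Summable fun r : ℤ => zwegersTerm K τ v r * thetaJK (σ * r) K τ w :=
    hs.prod.congr hr
  rw [hs.tsum_prod]
  simp_rw [hr]
  rw [tsum_eq_sum_range_tsum (N := 2 * K) (by lia) hs1]
  refine Finset.sum_congr rfl fun j _ => ?_
  have ht : ∀ l : ℤ, thetaJK (σ * (j + (2 * K : ℕ) * l)) K τ w = thetaJK (σ * j) K τ w := by
    intro l
    rw [← thetaJK_add_mul hK τ w (σ * j) (σ * l)]
    congr 1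
    push_cast
    ring
  simp_rw [ht]
  rw [tsum_mul_right]
  congr 1

/-! ### The lattice representation of the modified function -/

theorem theta_factor_mul_exp {K : ℕ} (hK : 0 < K) (τ z₁ z₂ : ℂ) (j r : ℤ) :
    cexp (2 * pi * I * j * K * (z₁ + z₂)) * cexp (2 * pi * I * τ * (j ^ 2 * K))
        * cexp (2 * pi * I * r * (z₂ + j * τ)) =
      cexp (-(pi * I * (r : ℂ) ^ 2 / (2 * K)) * τ - 2 * pi * I * r * ((z₁ - z₂) / 2))
        * thetaTerm K τ (z₁ + z₂) r j := by
  have hK' : (K : ℂ) ≠ 0 := by exact_mod_cast hK.ne'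
  rw [thetaTerm, ← Complex.exp_add, ← Complex.exp_add, ← Complex.exp_add]
  congr 1
  field_simp
  ring

theorem theta_factor_mul_exp_neg {K : ℕ} (hK : 0 < K) (τ z₁ z₂ : ℂ) (j r : ℤ) :
    cexp (2 * pi * I * j * K * (z₁ + z₂)) * cexp (2 * pi * I * τ * (j ^ 2 * K))
        * cexp (-(2 * pi * I * r * (z₁ + j * τ))) =
      cexp (-(pi * I * (r : ℂ) ^ 2 / (2 * K)) * τ - 2 * pi * I * r * ((z₁ - z₂) / 2))
        * thetaTerm K τ (z₁ + z₂) (-r) j := by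
  have hK' : (K : ℂ) ≠ 0 := by exact_mod_cast hK.ne'
  rw [thetaTerm, ← Complex.exp_add, ← Complex.exp_add, ← Complex.exp_add]
  congr 1
  push_cast
  field_simp
  ring

theorem zwegers_coeff_eq (K : ℕ) (τ z₁ z₂ : ℂ) :
    2 * (K : ℝ) * (((z₁ - z₂) / 2).im / τ.im) = K * (z₁.im - z₂.im) / τ.im := by
  have : ((z₁ - z₂) / 2).im = (z₁.im - z₂.im) / 2 := by
    rw [div_ofNat_im, sub_im]
  rw [this]
  ring

theorem tsum_latTerm_row₁ {K : ℕ} (hK : 0 < K) {τ : ℂ} (hτ : 0 < τ.im) (z₁ z₂ : ℂ) (j : ℤ)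
    (h : ∀ n : ℤ, z₁ + j * τ + n ≠ 0) :
    I / (2 * pi) * ∑' a : ℤ, latTerm K τ z₁ z₂ (j, a) =
      cexp (2 * pi * I * j * K * (z₁ + z₂)) * cexp (2 * pi * I * τ * (j ^ 2 * K))
          / (1 - cexp (2 * pi * I * z₁) * cexp (2 * pi * I * τ * j))
        - cexp (2 * pi * I * j * K * (z₁ + z₂)) * cexp (2 * pi * I * τ * (j ^ 2 * K))
        + 1 / 2 * ∑' r : ℤ, zwegersTerm K τ ((z₁ - z₂) / 2) r
            * thetaTerm K τ (z₁ + z₂) (-1 * r) j := by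
  have he : cexp (2 * pi * I * z₁) * cexp (2 * pi * I * τ * j)
      = cexp (2 * pi * I * (z₁ + j * τ)) := by
    rw [← Complex.exp_add]; congr 1; ring
  have hr : ∀ r : ℤ, zwegersTerm K τ ((z₁ - z₂) / 2) r * thetaTerm K τ (z₁ + z₂) (-1 * r) j =
      cexp (2 * pi * I * j * K * (z₁ + z₂)) * cexp (2 * pi * I * τ * (j ^ 2 * K)) *
        ((signSubErr (τ.im / K) (K * (z₁.im - z₂.im) / τ.im) r : ℂ)
              * cexp (-(2 * pi * I * r * (z₁ + j * τ)))) := by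
    intro r
    rw [mul_left_comm, theta_factor_mul_exp_neg hK, zwegersTerm, zwegers_coeff_eq, mul_assoc,
      neg_one_mul]
  simp_rw [hr]
  rw [tsum_latTerm_row_reflected hK hτ z₁ z₂ j h, he, tsum_mul_left]
  ring

theorem tsum_latTerm_row₂ {K : ℕ} (hK : 0 < K) {τ : ℂ} (hτ : 0 < τ.im) (z₁ z₂ : ℂ) (j : ℤ)
    (h : ∀ n : ℤ, z₂ + j * τ + n ≠ 0) :
    I / (2 * pi) * ∑' a : ℤ, latTerm K τ z₂ z₁ (j, a) =
      cexp (2 * pi * I * j * K * (z₁ + z₂)) * cexp (2 * pi * I * τ * (j ^ 2 * K))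
        - cexp (2 * pi * I * j * K * (z₁ + z₂)) * cexp (2 * pi * I * τ * (j ^ 2 * K))
          / (1 - cexp (-(2 * pi * I * z₂)) * cexp (2 * pi * I * τ * (-j : ℤ)))
        - 1 / 2 * ∑' r : ℤ, zwegersTerm K τ ((z₁ - z₂) / 2) r
            * thetaTerm K τ (z₁ + z₂) (1 * r) j := by
  have hne : 1 - cexp (2 * pi * I * (z₂ + j * τ)) ≠ 0 :=
    sub_ne_zero.2 (cexp_two_pi_ne_one h).symm
  have he : cexp (-(2 * pi * I * z₂)) * cexp (2 * pi * I * τ * (-j : ℤ))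
      = (cexp (2 * pi * I * (z₂ + j * τ)))⁻¹ := by
    rw [← Complex.exp_add, ← Complex.exp_neg]
    congr 1
    push_cast
    ring
  have he1 : 1 / (1 - (cexp (2 * pi * I * (z₂ + j * τ)))⁻¹)
      = 1 - 1 / (1 - cexp (2 * pi * I * (z₂ + j * τ))) := by
    have := Complex.exp_ne_zero (2 * pi * I * (z₂ + j * τ))
    have h2 : cexp (2 * pi * I * (z₂ + j * τ)) - 1 ≠ 0 := by
      rw [← neg_sub]; exact neg_ne_zero.2 hne
    field_simp
    ring
  have hr : ∀ r : ℤ, zwegersTerm K τ ((z₁ - z₂) / 2) r * thetaTerm K τ (z₁ + z₂) (1 * r) j =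
      cexp (2 * pi * I * j * K * (z₁ + z₂)) * cexp (2 * pi * I * τ * (j ^ 2 * K)) *
        ((signSubErr (τ.im / K) (K * (z₁.im - z₂.im) / τ.im) r : ℂ)
              * cexp (2 * pi * I * r * (z₂ + j * τ))) := by
    intro r
    rw [mul_left_comm, theta_factor_mul_exp hK, zwegersTerm, zwegers_coeff_eq, mul_assoc, one_mul]
  simp_rw [hr]
  rw [tsum_latTerm_row hK hτ z₂ z₁ j h, he, tsum_mul_left, div_eq_mul_one_div _ (1 - _⁻¹), he1,
    add_comm z₂ z₁]
  ring

theorem summable_theta_factor {K : ℕ} (hK : 0 < K) {τ : ℂ} (hτ : 0 < τ.im) (w : ℂ) :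
    Summable fun j : ℤ =>
      cexp (2 * pi * I * j * K * w) * cexp (2 * pi * I * τ * (j ^ 2 * K)) := by
  have hK' : (0 : ℝ) < K := by exact_mod_cast hK
  refine ((summable_jacobiTheta₂_term_iff (K * w) (2 * K * τ)).2 ?_).congr fun j => ?_
  · have : (2 * K * τ : ℂ).im = 2 * K * τ.im := by
      rw [show (2 * K * τ : ℂ) = ((2 * K : ℝ) : ℂ) * τ by push_cast; ring, im_ofReal_mul]
    rw [this]
    positivity
  · rw [jacobiTheta₂_term, ← Complex.exp_add]
    congr 1
    ring

theorem mockPhi_series_eq {K : ℕ} (hK : 0 < K) {τ z₁ z₂ : ℂ} (hτ : 0 < τ.im)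
    (h₁ : ∀ j n : ℤ, z₁ + j * τ + n ≠ 0) (h₂ : ∀ j n : ℤ, z₂ + j * τ + n ≠ 0) :
    ∑' j : ℤ,
      (cexp (2 * pi * I * j * K * (z₁ + z₂)) * cexp (2 * pi * I * τ * (j ^ 2 * K))
          / (1 - cexp (2 * pi * I * z₁) * cexp (2 * pi * I * τ * j))
        - cexp (-(2 * pi * I * j * K * (z₁ + z₂))) * cexp (2 * pi * I * τ * (j ^ 2 * K))
          / (1 - cexp (-(2 * pi * I * z₂)) * cexp (2 * pi * I * τ * j))) =
      I / (2 * pi) * (latSum K τ z₁ z₂ + latSum K τ z₂ z₁)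
        + 1 / 2 * ∑ j ∈ Finset.range (2 * K), zwegersR K j τ ((z₁ - z₂) / 2)
            * (thetaJK j K τ (z₁ + z₂) - thetaJK (-(j : ℤ)) K τ (z₁ + z₂)) := by
  have hL₁ := (summable_latTerm hK hτ z₁ z₂).hasSum
  have hL₂ := (summable_latTerm hK hτ z₂ z₁).hasSum
  have hr₁ := (hL₁.prod_fiberwise fun j =>
    ((summable_latTerm hK hτ z₁ z₂).prod_factor j).hasSum).mul_left (I / (2 * pi))
  have hr₂ := (hL₂.prod_fiberwise fun j =>
    ((summable_latTerm hK hτ z₂ z₁).prod_factor j).hasSum).mul_left (I / (2 * pi))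
  have hP := (summable_theta_factor hK hτ (z₁ + z₂)).hasSum
  have hW : ∀ σ : ℤ, σ ^ 2 = 1 → HasSum (fun j : ℤ => ∑' r : ℤ,
      zwegersTerm K τ ((z₁ - z₂) / 2) r * thetaTerm K τ (z₁ + z₂) (σ * r) j)
      (∑ j ∈ Finset.range (2 * K), zwegersR K j τ ((z₁ - z₂) / 2)
        * thetaJK (σ * j) K τ (z₁ + z₂)) := by
    intro σ hσ
    have hs := summable_zwegersTerm_mul_thetaTerm hK hτ ((z₁ - z₂) / 2) (z₁ + z₂) hσ
    rw [sum_zwegersR_mul_thetaJK hK hτ _ _ hσ, ← (Equiv.prodComm ℤ ℤ).tsum_eq]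
    have hs' := (Equiv.prodComm ℤ ℤ).summable_iff.2 hs
    exact hs'.hasSum.prod_fiberwise fun j => (hs'.prod_factor j).hasSum
  have hW₁ := (hW 1 (by norm_num)).mul_left (1 / 2)
  have hW₂ := (hW (-1) (by norm_num)).mul_left (1 / 2)
  -- `hA` and `hB` isolate the two kinds of Appell summands. The theta series `hP` occurs in both
  -- and drops out of the difference; `hB` is reindexed by `j ↦ -j` to match `mockPhi`.
  have hA := (hr₁.add hP).sub hW₂
  have hB := (hP.sub hr₂).sub hW₁
  have hB' := (Equiv.neg ℤ).hasSum_iff.2 hB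
  have hAB := hA.sub hB'
  have hsum : ∑ j ∈ Finset.range (2 * K), zwegersR K j τ ((z₁ - z₂) / 2)
            * (thetaJK j K τ (z₁ + z₂) - thetaJK (-(j : ℤ)) K τ (z₁ + z₂)) =
      ∑ j ∈ Finset.range (2 * K), zwegersR K j τ ((z₁ - z₂) / 2)
          * thetaJK (1 * j) K τ (z₁ + z₂)
        - ∑ j ∈ Finset.range (2 * K), zwegersR K j τ ((z₁ - z₂) / 2)
          * thetaJK (-1 * j) K τ (z₁ + z₂) := by
    rw [← Finset.sum_sub_distrib]
    refine Finset.sum_congr rfl fun j _ => ?_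
    rw [one_mul, neg_one_mul, mul_sub]
  rw [hsum]
  refine (tsum_congr fun j => ?_).trans (hAB.tsum_eq.trans ?_)
  · simp only [Function.comp_apply, Equiv.neg_apply]
    rw [tsum_latTerm_row₁ hK hτ z₁ z₂ j (h₁ j), tsum_latTerm_row₂ hK hτ z₁ z₂ (-j) (h₂ (-j)),
      neg_neg]
    have e1 : cexp (2 * pi * I * (-j : ℤ) * K * (z₁ + z₂))
        = cexp (-(2 * pi * I * j * K * (z₁ + z₂))) := by
      congr 1; push_cast; ring
    have e2 : (((-j : ℤ) : ℂ)) ^ 2 = (j : ℂ) ^ 2 := by push_cast; ring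
    rw [e1, e2]
    ring
  · unfold latSum
    ring

theorem modPhi_eq_latSum (m : ℕ) {τ z₁ z₂ : ℂ} (t : ℂ) (hτ : 0 < τ.im)
    (h₁ : ∀ j n : ℤ, z₁ + j * τ + n ≠ 0) (h₂ : ∀ j n : ℤ, z₂ + j * τ + n ≠ 0) :
    modPhi m τ z₁ z₂ t = cexp (2 * pi * I * (m + 1) * t) *
      (I / (2 * pi) * (latSum (m + 1) τ z₁ z₂ + latSum (m + 1) τ z₂ z₁)) := by
  have h := mockPhi_series_eq (Nat.succ_pos m) hτ h₁ h₂
  rw [Nat.cast_succ] at h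
  rw [modPhi, mockPhi, corrPhi, h]
  change _ + -(1 / 2) * _ * (∑ j ∈ Finset.range (2 * (m + 1)), _) = _
  ring

theorem PhiDefinedAt.ne_zero {τ z₁ z₂ : ℂ} (h : PhiDefinedAt τ z₁ z₂) (j n : ℤ) :
    z₁ + j * τ + n ≠ 0 ∧ z₂ + j * τ + n ≠ 0 := by
  constructor
  · intro h0
    refine (h j).1 (sub_eq_zero.2 (Eq.symm ?_))
    rw [← Complex.exp_add, Complex.exp_eq_one_iff]
    exact ⟨-n, by push_cast; linear_combination (2 * pi * I) * h0⟩
  · intro h0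
    refine (h (-j)).2 (sub_eq_zero.2 (Eq.symm ?_))
    rw [← Complex.exp_add, Complex.exp_eq_one_iff]
    exact ⟨n, by push_cast; linear_combination (-2 * pi * I) * h0⟩

/-! ### The lattice representation of `modPsi` -/

/-- The Gaussian-damped pole at `z₁ = -(J τ + N)`. -/
noncomputable def gaussPole (M K : ℕ) (τ z₁ z₂ J N : ℂ) : ℂ :=
  cexp (-(pi * K / (M * τ.im) : ℝ)
    * ((z₁ + J * τ + N) * (conj (z₁ + J * τ + N) + (z₂ - conj z₂)))) / (z₁ + J * τ + N)

/-- The summands of `psiHalf`. -/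
noncomputable def psiTerm (M K : ℕ) (ε j k τ z₁ z₂ J N : ℂ) : ℂ :=
  cexp (2 * pi * I * K / M * (J * z₂ - k * N + (J - j) * ε)) * gaussPole M K τ z₁ z₂ J N

/-- The part of `modPsi` that carries its poles in `z₁`, up to normalization. -/
noncomputable def psiHalf (M K : ℕ) (ε j k τ z₁ z₂ : ℂ) : ℂ :=
  ∑' p : ℤ × ℤ, psiTerm M K ε j k τ z₁ z₂ (j + M * p.1) (ε + p.2)

theorem prefactor_mul_latTerm {M : ℕ} (hM : 0 < M) (K : ℕ) {ε k τ : ℂ} (j z₁ z₂ : ℂ)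
    (hτ : 0 < τ.im) (hε : conj ε = ε) (hk : conj k = k) (p : ℤ × ℤ) :
    cexp (2 * pi * I * τ * (K * j * k / M)) * cexp (2 * pi * I * K / M * (k * z₁ + j * z₂))
        * latTerm K (M * τ) (z₁ + j * τ + ε) (z₂ + k * τ + ε) p =
      psiTerm M K ε j k τ z₁ z₂ (j + M * p.1) (ε + p.2) := by
  have hM' : (M : ℂ) ≠ 0 := by exact_mod_cast hM.ne'
  have hy : (τ.im : ℂ) ≠ 0 := by exact_mod_cast hτ.ne'
  have him : ((M : ℂ) * τ).im = M * τ.im := by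
    rw [show (M : ℂ) = ((M : ℝ) : ℂ) by push_cast; rfl, im_ofReal_mul]
  have hω : z₁ + j * τ + ε + p.1 * (M * τ) + p.2 = z₁ + (j + M * p.1) * τ + (ε + p.2) := by ring
  have hz : z₂ + k * τ + ε - conj (z₂ + k * τ + ε) = z₂ - conj z₂ + 2 * I * k * τ.im := by
    have h1 : τ - conj τ = 2 * I * τ.im := by rw [sub_conj]; push_cast; ring
    simp only [map_add, map_mul, hε, hk]
    linear_combination k * h1
  rw [latTerm, psiTerm, gaussPole, him, hω, hz]
  generalize hs : z₁ + (j + M * p.1) * τ + (ε + p.2) = s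
  obtain rfl : z₁ = s - (j + M * p.1) * τ - (ε + p.2) := by rw [← hs]; ring
  rw [← mul_div_assoc _ _ s, ← mul_div_assoc _ _ s]
  congr 1
  simp only [← Complex.exp_add]
  congr 1
  push_cast
  field_simp
  ring

theorem modPsi_eq_psiHalf {M : ℕ} (hM : 0 < M) (m : ℕ) {ε j k τ z₁ z₂ : ℂ} (t : ℂ)
    (hτ : 0 < τ.im) (hε : conj ε = ε) (hj : conj j = j) (hk : conj k = k)
    (h₁ : ∀ p n : ℤ, z₁ + j * τ + ε + p * (M * τ) + n ≠ 0)
    (h₂ : ∀ p n : ℤ, z₂ + k * τ + ε + p * (M * τ) + n ≠ 0) :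
    modPsi M m ε j k τ z₁ z₂ t = cexp (2 * pi * I * (m + 1) * (t / M)) * (I / (2 * pi)) *
      (psiHalf M (m + 1) ε j k τ z₁ z₂ + psiHalf M (m + 1) ε k j τ z₂ z₁) := by
  have him : 0 < ((M : ℂ) * τ).im := by
    rw [show (M : ℂ) = ((M : ℝ) : ℂ) by push_cast; rfl, im_ofReal_mul]
    have : (0 : ℝ) < M := by exact_mod_cast hM
    positivity
  rw [modPsi, modPhi_eq_latSum m _ him h₁ h₂, psiHalf, psiHalf, latSum, latSum]
  simp_rw [← prefactor_mul_latTerm hM (m + 1) j z₁ z₂ hτ hε hk,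
    ← prefactor_mul_latTerm hM (m + 1) k z₂ z₁ hτ hε hj]
  rw [tsum_mul_left, tsum_mul_left]
  have e1 : 2 * pi * I * τ * (((m + 1 : ℕ) : ℂ) * k * j / M)
      = 2 * pi * I * τ * ((m + 1) * j * k / M) := by push_cast; ring
  have e2 : 2 * pi * I * ((m + 1 : ℕ) : ℂ) / M * (j * z₂ + k * z₁)
      = 2 * pi * I * (m + 1) / M * (k * z₁ + j * z₂) := by push_cast; ring
  rw [e1, e2, Nat.cast_succ]
  ring

/-! ### The transformation under `τ ↦ τ + 1` -/

/-- The pole `J(τ + 1) + N` is `Jτ + (N + J)`, so the sum is reindexed by a shear. -/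
theorem psiHalf_add_one {M : ℕ} (hM : 0 < M) (K : ℕ) {ε ε'' j k : ℂ} (τ z₁ z₂ : ℂ) {l l' : ℤ}
    (hl : j + ε = ε'' + l) (hl' : k + ε = ε'' + l') :
    psiHalf M K ε j k (τ + 1) z₁ z₂ =
      cexp (2 * pi * I * (K * j * k / M)) * psiHalf M K ε'' j k τ z₁ z₂ := by
  have hM' : (M : ℂ) ≠ 0 := by exact_mod_cast hM.ne'
  let e : ℤ × ℤ ≃ ℤ × ℤ := Equiv.prodShear (Equiv.refl ℤ) fun p => Equiv.addRight (M * p + l)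
  rw [psiHalf, psiHalf, ← tsum_mul_left]
  refine Eq.trans (tsum_congr fun p => ?_) (e.tsum_eq _)
  have he1 : (e p).1 = p.1 := rfl
  have he2 : (((e p).2 : ℤ) : ℂ) = p.2 + (M * p.1 + l) := by
    change ((p.2 + (M * p.1 + l) : ℤ) : ℂ) = _
    push_cast
    ring
  have hω : z₁ + (j + M * p.1) * (τ + 1) + (ε + p.2)
      = z₁ + (j + M * p.1) * τ + (ε'' + (p.2 + (M * p.1 + l))) := by
    linear_combination hl
  have him : (τ + 1).im = τ.im := by simp
  rw [he1, he2, psiTerm, psiTerm, gaussPole, gaussPole, hω, him]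
  have factor : ∀ {a b c G : ℂ}, a = b * c → a * G = b * (c * G) :=
    fun {a b c G} hab => by linear_combination G * hab
  refine factor ?_
  rw [← Complex.exp_add]
  rw [Complex.exp_eq_exp_iff_exists_int]
  -- The phases differ by `exp(2πi K p.1 l')`, which is 1; this is where the class of `k` enters.
  refine ⟨K * p.1 * l', ?_⟩
  obtain rfl : ε'' = j + ε - l := by linear_combination -hl
  obtain rfl : k = j - l + l' := by linear_combination hl'
  push_cast
  field_simp
  ring

/-! ### The transformation under `τ ↦ -1 / τ` -/

/-- The pole denominator becomes `ω / τ` and `Im(-1/τ) = Im τ / |τ|²`, so `|ω|² / Im τ` is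
unchanged; only the `z₂` terms produce the exponential factor. -/
theorem gaussPole_neg_inv {M : ℕ} (hM : 0 < M) (K : ℕ) {τ : ℂ} (hτ : 0 < τ.im) (z₁ z₂ J N : ℂ) :
    gaussPole M K (-1 / τ) (z₁ / τ) (z₂ / τ) (-N) J =
      τ * cexp (2 * pi * I * K / M * ((z₁ + J * τ + N) * z₂ / τ)) * gaussPole M K τ z₁ z₂ J N := by
  have hM' : (M : ℂ) ≠ 0 := by exact_mod_cast hM.ne'
  have hy : (τ.im : ℂ) ≠ 0 := by exact_mod_cast hτ.ne'
  have hτ0 : τ ≠ 0 := by rintro rfl; simp at hτ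
  have hτc : conj τ ≠ 0 := by simpa using hτ0
  have him : (((-1 / τ).im : ℝ) : ℂ) = τ.im / (τ * conj τ) := by
    rw [mul_conj, neg_div, one_div, neg_im, inv_im]
    push_cast
    ring
  have hω : z₁ / τ + -N * (-1 / τ) + J = (z₁ + J * τ + N) / τ := by
    field_simp
    ring
  have hconj : conj τ = τ - 2 * I * τ.im := by
    have : τ - conj τ = 2 * I * τ.im := by rw [sub_conj]; push_cast; ring
    linear_combination -this
  have hexp : -(pi * K / (M * (-1 / τ).im) : ℝ) * ((z₁ + J * τ + N) / τ
        * (conj (z₁ + J * τ + N) / conj τ + (z₂ / τ - conj z₂ / conj τ)))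
      = 2 * pi * I * K / M * ((z₁ + J * τ + N) * z₂ / τ)
        + -(pi * K / (M * τ.im) : ℝ)
          * ((z₁ + J * τ + N) * (conj (z₁ + J * τ + N) + (z₂ - conj z₂))) := by
    push_cast
    rw [him]
    generalize conj (z₁ + J * τ + N) = ω'
    generalize conj z₂ = z'
    field_simp
    rw [hconj]
    ring
  rw [gaussPole, gaussPole, hω, map_div₀, map_div₀, hexp, Complex.exp_add]
  -- At a pole both sides are 0, as division by zero gives 0, so no nonvanishing hypothesis is
  -- needed.
  rcases eq_or_ne (z₁ + J * τ + N) 0 with h0 | h0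
  · simp [h0]
  · field_simp

theorem tsum_residue {M : ℕ} (hM : 0 < M) (f : ℤ × ℤ → ℂ) (a : ℤ) :
    ∑' p : ℤ × ℤ, f (a + M * p.1, p.2) =
      ∑' q : ℤ × ℤ, if (a : ZMod M) = (q.1 : ZMod M) then f q else 0 := by
  have hM' : (M : ℤ) ≠ 0 := by exact_mod_cast hM.ne'
  have hinj : Function.Injective fun p : ℤ × ℤ => (a + M * p.1, p.2) := by
    rintro ⟨p, n⟩ ⟨p', n'⟩ h
    simp only [Prod.mk.injEq, add_right_inj, mul_eq_mul_left_iff, hM', or_false] at h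
    simp [h]
  refine Eq.trans ?_ (hinj.tsum_eq ?_)
  · refine tsum_congr fun p => ?_
    simp
  · intro q hq
    simp only [Function.mem_support, ne_eq, ite_eq_right_iff, Classical.not_imp] at hq
    obtain ⟨p, hp⟩ := (ZMod.intCast_eq_intCast_iff_dvd_sub _ _ _).1 hq.1
    exact ⟨(p, q.2), by simp [← hp]⟩

theorem tsum_dvd {M : ℕ} (hM : 0 < M) (f : ℤ × ℤ → ℂ) (h : ℤ) :
    ∑' p : ℤ × ℤ, f (p.2, -h - M * p.1) =
      ∑' q : ℤ × ℤ, if (M : ℤ) ∣ q.2 + h then f q else 0 := by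
  have hM' : (M : ℤ) ≠ 0 := by exact_mod_cast hM.ne'
  have hinj : Function.Injective fun p : ℤ × ℤ => (p.2, -h - M * p.1) := by
    rintro ⟨p, n⟩ ⟨p', n'⟩ h
    simp only [Prod.mk.injEq, sub_right_inj, mul_eq_mul_left_iff, hM', or_false] at h
    simp [h]
  refine Eq.trans ?_ (hinj.tsum_eq ?_)
  · refine tsum_congr fun p => ?_
    rw [if_pos]
    exact ⟨-p.1, by ring⟩
  · intro q hq
    simp only [Function.mem_support, ne_eq, ite_eq_right_iff, Classical.not_imp] at hq
    obtain ⟨p, hp⟩ := hq.1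
    refine ⟨(-p, q.1), Prod.ext rfl ?_⟩
    simp only
    linear_combination -hp

/-- The summands that both sides of the transformation under `τ ↦ -1 / τ` have in common. -/
noncomputable def dualTerm (M K : ℕ) (ε ε' k τ z₁ z₂ : ℂ) (h : ℤ) (q : ℤ × ℤ) : ℂ :=
  cexp (2 * pi * I * K / M * ((ε + q.1) * (z₂ - k) - ε * (q.2 + h)))
    * gaussPole M K τ z₁ z₂ (ε + q.1) (ε' + q.2)

theorem summable_dualTerm {M K : ℕ} (hM : 0 < M) (hK : 0 < K) {ε k τ : ℂ} (ε' z₁ z₂ : ℂ) (h : ℤ)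
    (hτ : 0 < τ.im) (hε : conj ε = ε) (hk : conj k = k) :
    Summable (dualTerm M K ε ε' k τ z₁ z₂ h) := by
  have hM' : (M : ℂ) ≠ 0 := by exact_mod_cast hM.ne'
  have hκ : (0 : ℝ) < K / M := div_pos (by exact_mod_cast hK) (by exact_mod_cast hM)
  have hs := (summable_lattice_gaussian hκ hτ (z₁ + ε * τ + ε') z₂).norm.mul_left
    ‖cexp (2 * pi * I * K / M * (ε * z₂))‖
  refine Summable.of_norm (hs.congr fun q => ?_)
  obtain ⟨e, rfl⟩ := conj_eq_iff_real.1 hε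
  obtain ⟨k, rfl⟩ := conj_eq_iff_real.1 hk
  have hphase : ‖cexp ((-(2 * pi * K / M * ((e + q.1) * k + e * (q.2 + h))) : ℝ) * I)‖ = 1 :=
    norm_exp_ofReal_mul_I _
  have hω : z₁ + e * τ + ε' + q.1 * τ + q.2 = z₁ + (e + q.1) * τ + (ε' + q.2) := by ring
  have hc : pi * (K / M) / τ.im = pi * K / (M * τ.im) := by
    have := hτ.ne'
    have : (M : ℝ) ≠ 0 := by exact_mod_cast hM.ne'
    field_simp
  rw [← norm_mul, ← one_mul ‖_ * _‖, ← hphase, ← norm_mul, dualTerm, gaussPole, hω, hc,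
    mul_div_assoc _ _ (z₁ + (e + q.1) * τ + (ε' + q.2)), ← mul_assoc, ← mul_assoc]
  congr 2
  rw [← Complex.exp_add, ← Complex.exp_add]
  congr 1
  push_cast
  field_simp
  ring

theorem psiHalf_neg_inv {M : ℕ} (hM : 0 < M) (K : ℕ) {ε ε' j k τ : ℂ} (z₁ z₂ : ℂ) {h : ℤ}
    (hτ : 0 < τ.im) (hj : ε' + j = h) :
    psiHalf M K ε j k (-1 / τ) (z₁ / τ) (z₂ / τ) =
      τ * cexp (2 * pi * I * K * z₁ * z₂ / (M * τ)) *
        ∑' q : ℤ × ℤ, if (M : ℤ) ∣ q.2 + h then dualTerm M K ε ε' k τ z₁ z₂ h q else 0 := by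
  have hM' : (M : ℂ) ≠ 0 := by exact_mod_cast hM.ne'
  have hτ0 : τ ≠ 0 := by rintro rfl; simp at hτ
  rw [← tsum_dvd hM, psiHalf, ← tsum_mul_left]
  refine tsum_congr fun p => ?_
  obtain rfl : ε' = h - j := by linear_combination hj
  have hJ : j + M * p.1 = -(h - j + ((-h - M * p.1 : ℤ) : ℂ)) := by
    push_cast
    ring
  rw [psiTerm, dualTerm]
  -- Only the occurrence inside `gaussPole` is rewritten, to match the argument `-N`.
  nth_rewrite 3 [hJ]
  rw [gaussPole_neg_inv hM K hτ]
  have factor : ∀ {a b c d G : ℂ}, a * b = c * d → a * (τ * b * G) = τ * c * (d * G) :=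
    fun {a b c d G} hab => by linear_combination τ * G * hab
  refine factor ?_
  rw [← Complex.exp_add, ← Complex.exp_add]
  congr 1
  push_cast
  field_simp
  ring

/-- The residues `a i` partition the first coordinate, and orthogonality of characters in `b i`
yields `M` times the indicator of `M ∣ K (q.2 + h)`. Coprimality of `K` and `M` removes `K`. -/
theorem sum_psiHalf {M K : ℕ} (hM : 0 < M) (hK : 0 < K) (hKM : Nat.Coprime K M)
    {ε ε' j k τ : ℂ} (z₁ z₂ : ℂ) {h h' : ℤ} (hτ : 0 < τ.im) (hε : conj ε = ε) (hk' : conj k = k)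
    (hj : ε' + j = h) (hk : ε' + k = h') {ι : Type*} (s : Finset ι) (a b : ι → ℤ)
    (hs : ∀ g : ZMod M × ZMod M → ℂ,
      ∑ i ∈ s, g ((a i : ZMod M), (b i : ZMod M)) = ∑ᶠ x, g x) :
    ∑ i ∈ s, cexp (-(2 * pi * I * K / M * ((ε + a i) * k + (ε + b i) * j)))
        * psiHalf M K ε' (ε + a i) (ε + b i) τ z₁ z₂ =
      M * ∑' q : ℤ × ℤ, if (M : ℤ) ∣ q.2 + h then dualTerm M K ε ε' k τ z₁ z₂ h q else 0 := by
  have : NeZero M := ⟨hM.ne'⟩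
  have hM' : (M : ℂ) ≠ 0 := by exact_mod_cast hM.ne'
  set D := dualTerm M K ε ε' k τ z₁ z₂ h with hD
  have hDs : Summable D := summable_dualTerm hM hK ε' z₁ z₂ h hτ hε hk'
  let κ : ℤ × ℤ → ZMod M := fun q => ((-(K * (q.2 + h)) : ℤ) : ZMod M)
  have hterm : ∀ i, cexp (-(2 * pi * I * K / M * ((ε + a i) * k + (ε + b i) * j)))
        * psiHalf M K ε' (ε + a i) (ε + b i) τ z₁ z₂ =
      ∑' q : ℤ × ℤ, if (a i : ZMod M) = (q.1 : ZMod M)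
        then D q * ZMod.stdAddChar ((b i : ZMod M) * κ q) else 0 := by
    intro i
    rw [← tsum_residue hM (fun q => D q * ZMod.stdAddChar ((b i : ZMod M) * κ q)), psiHalf,
      ← tsum_mul_left]
    refine tsum_congr fun p => ?_
    have hJ : ε + ((a i + M * p.1 : ℤ) : ℂ) = ε + a i + M * p.1 := by push_cast; ring
    simp only [hD, κ]
    rw [← Int.cast_mul, ZMod.stdAddChar_coe, psiTerm, dualTerm, hJ]
    have factor : ∀ {a b c d G : ℂ}, a * b = c * d → a * (b * G) = c * G * d :=
      fun {a b c d G} hab => by linear_combination G * hab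
    refine factor ?_
    rw [← Complex.exp_add, ← Complex.exp_add]
    rw [Complex.exp_eq_exp_iff_exists_int]
    -- Moving the first coordinate within its class modulo `M` changes the phase by an integer
    -- multiple of `2πi`, because `ε' + k = h'` is an integer.
    refine ⟨K * p.1 * h', ?_⟩
    obtain rfl : j = h - ε' := by linear_combination hj
    obtain rfl : k = h' - ε' := by linear_combination hk
    push_cast
    field_simp
    ring
  simp_rw [hterm]
  rw [← Summable.tsum_finsetSum, ← tsum_mul_left]
  · refine tsum_congr fun q => ?_
    rw [hs fun x => if x.1 = (q.1 : ZMod M) then D q * ZMod.stdAddChar (x.2 * κ q) else 0,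
      finsum_eq_sum_of_fintype, Fintype.sum_prod_type, Finset.sum_comm]
    simp only [Finset.sum_ite_eq', Finset.mem_univ, if_true]
    rw [← Finset.mul_sum, AddChar.sum_mulShift _ (ZMod.isPrimitive_stdAddChar M), ZMod.card]
    have hκ : κ q = 0 ↔ (M : ℤ) ∣ q.2 + h := by
      simp only [κ]
      rw [ZMod.intCast_zmod_eq_zero_iff_dvd, Int.dvd_neg]
      constructor
      · exact fun hd => (Int.isCoprime_iff_gcd_eq_one.2 (by
          simpa [Int.gcd_natCast_natCast] using hKM.symm)).dvd_of_dvd_mul_left hd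
      · exact fun hd => Dvd.dvd.mul_left hd _
    simp only [hκ]
    split_ifs
    · ring
    · simp
  · intro i _
    refine Summable.of_norm_bounded hDs.norm fun q => ?_
    split_ifs
    · rw [norm_mul, AddChar.norm_apply, mul_one]
    · simp

theorem psiHalf_neg_inv_eq_sum {M K : ℕ} (hM : 0 < M) (hK : 0 < K) (hKM : Nat.Coprime K M)
    {ε ε' j k τ : ℂ} (z₁ z₂ : ℂ) {h h' : ℤ} (hτ : 0 < τ.im) (hε : conj ε = ε) (hk' : conj k = k)
    (hj : ε' + j = h) (hk : ε' + k = h') {ι : Type*} (s : Finset ι) (a b : ι → ℤ)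
    (hs : ∀ g : ZMod M × ZMod M → ℂ,
      ∑ i ∈ s, g ((a i : ZMod M), (b i : ZMod M)) = ∑ᶠ x, g x) :
    psiHalf M K ε j k (-1 / τ) (z₁ / τ) (z₂ / τ) =
      τ / M * cexp (2 * pi * I * K * z₁ * z₂ / (M * τ)) *
        ∑ i ∈ s, cexp (-(2 * pi * I * K / M * ((ε + a i) * k + (ε + b i) * j)))
          * psiHalf M K ε' (ε + a i) (ε + b i) τ z₁ z₂ := by
  have hM' : (M : ℂ) ≠ 0 := by exact_mod_cast hM.ne'
  rw [sum_psiHalf hM hK hKM z₁ z₂ hτ hε hk' hj hk s a b hs, psiHalf_neg_inv hM K z₁ z₂ hτ hj]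
  field_simp

/-! ### Assembling the two transformation laws -/

theorem conj_eq_self_of_half {ε : ℂ} (hε : ε = 0 ∨ ε = 1 / 2) : conj ε = ε := by
  rcases hε with rfl | rfl
  · simp
  · rw [map_div₀, map_one, map_ofNat]

theorem conj_add_intCast {ε : ℂ} (hε : conj ε = ε) (n : ℤ) : conj (ε + n) = ε + n := by
  rw [map_add, hε, map_intCast]

theorem exists_add_self_eq_intCast {ε : ℂ} (hε : ε = 0 ∨ ε = 1 / 2) : ∃ e : ℤ, ε + ε = e := by
  rcases hε with rfl | rfl
  · exact ⟨0, by simp⟩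
  · exact ⟨1, by norm_num⟩

theorem modPsi_neg_inv {M m : ℕ} (hM : 0 < M) (hKM : Nat.Coprime (m + 1) M) {ε ε' j k τ : ℂ}
    (z₁ z₂ t : ℂ) {h h' : ℤ} (hτ : 0 < τ.im) (hε : conj ε = ε) (hε' : conj ε' = ε')
    (hj : ε' + j = h) (hk : ε' + k = h') (S : Finset (ℤ × ℤ))
    (hS : Set.BijOn (fun p : ℤ × ℤ => ((p.1 : ZMod M), (p.2 : ZMod M))) (S : Set (ℤ × ℤ)) Set.univ)
    (hdef : ∀ p ∈ S, PsiDefinedAt M ε' (ε + p.1) (ε + p.2) τ z₁ z₂) :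
    modPsi M m ε j k (-1 / τ) (z₁ / τ) (z₂ / τ) t =
      τ / M * cexp (2 * pi * I * (m + 1) * z₁ * z₂ / (M * τ)) *
        ∑ p ∈ S, cexp (-(2 * pi * I * (m + 1) / M * ((ε + p.1) * k + (ε + p.2) * j)))
          * modPsi M m ε' (ε + p.1) (ε + p.2) τ z₁ z₂ t := by
  have : NeZero M := ⟨hM.ne'⟩
  have hτ0 : τ ≠ 0 := by rintro rfl; simp at hτ
  have hτ' : 0 < (-1 / τ).im := by
    rw [neg_div, one_div, neg_im, inv_im, neg_div, neg_neg]
    exact div_pos hτ (normSq_pos.2 hτ0)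
  have hj' : conj j = j := by
    obtain rfl : j = h - ε' := by linear_combination hj
    rw [map_sub, hε', map_intCast]
  have hk' : conj k = k := by
    obtain rfl : k = h' - ε' := by linear_combination hk
    rw [map_sub, hε', map_intCast]
  have hs : ∀ g : ZMod M × ZMod M → ℂ,
      ∑ p ∈ S, g ((p.1 : ZMod M), (p.2 : ZMod M)) = ∑ᶠ x, g x := fun g => by
    rw [← finsum_mem_univ, ← finsum_mem_coe_finset]
    exact finsum_mem_eq_of_bijOn _ hS fun _ _ => rfl
  -- The second half has `z₁, z₂` and `j, k` exchanged, so it needs the representatives with swapped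
  -- coordinates.
  have hs' : ∀ g : ZMod M × ZMod M → ℂ,
      ∑ p ∈ S, g ((p.2 : ZMod M), (p.1 : ZMod M)) = ∑ᶠ x, g x := fun g => by
    exact (hs fun x => g x.swap).trans (finsum_comp_equiv (Equiv.prodComm _ _))
  -- The representatives in `S` reach every class modulo `M`, so definedness of the summands
  -- excludes all poles on the right; `hne'` transfers this to the left side.
  have hne : ∀ a n : ℤ, z₁ + (ε + a) * τ + (ε' + n) ≠ 0 ∧ z₂ + (ε + a) * τ + (ε' + n) ≠ 0 := by
    intro a n
    obtain ⟨p, hp, hpa⟩ := hS.surjOn (Set.mem_univ ((a : ZMod M), (a : ZMod M)))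
    simp only [Prod.mk.injEq] at hpa
    obtain ⟨c, hc⟩ := (ZMod.intCast_eq_intCast_iff_dvd_sub _ _ _).1 hpa.1
    obtain ⟨c', hc'⟩ := (ZMod.intCast_eq_intCast_iff_dvd_sub _ _ _).1 hpa.2
    have hc1 : (a : ℂ) = p.1 + M * c := by
      rw [← sub_eq_iff_eq_add']; exact_mod_cast hc
    have hc2 : (a : ℂ) = p.2 + M * c' := by
      rw [← sub_eq_iff_eq_add']; exact_mod_cast hc'
    have h1 := (PhiDefinedAt.ne_zero (hdef p hp) c n).1
    have h2 := (PhiDefinedAt.ne_zero (hdef p hp) c' n).2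
    constructor
    · rw [hc1]; convert h1 using 1; ring
    · rw [hc2]; convert h2 using 1; ring
  have hne' : ∀ {z i : ℂ} {l : ℤ}, ε' + i = l → (∀ a n : ℤ, z + (ε + a) * τ + (ε' + n) ≠ 0) →
      ∀ p n : ℤ, z / τ + i * (-1 / τ) + ε + p * (M * (-1 / τ)) + n ≠ 0 := by
    intro z i l hi hz p n h0
    obtain rfl : i = l - ε' := by linear_combination hi
    refine hz n (-l - M * p) ?_
    field_simp at h0
    push_cast
    linear_combination h0
  rw [modPsi_eq_psiHalf hM m t hτ' hε hj' hk' (hne' hj fun a n => (hne a n).1)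
    (hne' hk fun a n => (hne a n).2),
    psiHalf_neg_inv_eq_sum hM m.succ_pos hKM z₁ z₂ hτ hε hk' hj hk S _ _ hs,
    psiHalf_neg_inv_eq_sum hM m.succ_pos hKM z₂ z₁ hτ hε hj' hk hj S _ _ hs',
    mul_right_comm _ z₂ z₁, ← mul_add, ← Finset.sum_add_distrib, mul_left_comm, Finset.mul_sum,
    Nat.cast_succ]
  congr 1
  refine Finset.sum_congr rfl fun p hp => ?_
  have hd := PhiDefinedAt.ne_zero (hdef p hp)
  rw [modPsi_eq_psiHalf hM m t hτ hε' (conj_add_intCast hε _) (conj_add_intCast hε _)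
    (fun l n => (hd l n).1) (fun l n => (hd l n).2),
    add_comm ((ε + p.2) * j) ((ε + p.1) * k)]
  ring

theorem modPsi_add_one {M : ℕ} (hM : 0 < M) (m : ℕ) {ε ε'' j k τ z₁ z₂ : ℂ} (t : ℂ) {l l' : ℤ}
    (hτ : 0 < τ.im) (hε : conj ε = ε) (hj' : conj j = j) (hk' : conj k = k)
    (hl : j + ε = ε'' + l) (hl' : k + ε = ε'' + l') (hdef : PsiDefinedAt M ε j k (τ + 1) z₁ z₂) :
    modPsi M m ε j k (τ + 1) z₁ z₂ t =
      cexp (2 * pi * I * ((m + 1) * j * k / M)) * modPsi M m ε'' j k τ z₁ z₂ t := by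
  have hε'' : conj ε'' = ε'' := by
    obtain rfl : ε'' = j + ε - l := by linear_combination -hl
    rw [map_sub, map_add, hε, hj', map_intCast]
  have hd := PhiDefinedAt.ne_zero hdef
  have hne : ∀ {z i : ℂ} {l : ℤ}, i + ε = ε'' + l →
      (∀ p n : ℤ, z + i * (τ + 1) + ε + p * (M * (τ + 1)) + n ≠ 0) →
      ∀ p n : ℤ, z + i * τ + ε'' + p * (M * τ) + n ≠ 0 := by
    intro z i l hi hz p n h0
    refine hz p (n - l - p * M) ?_
    push_cast
    linear_combination h0 + hi
  have hτ' : 0 < (τ + 1).im := by simpa using hτ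
  rw [modPsi_eq_psiHalf hM m t hτ' hε hj' hk' (fun l n => (hd l n).1) (fun l n => (hd l n).2),
    modPsi_eq_psiHalf hM m t hτ hε'' hj' hk' (hne hl fun l n => (hd l n).1)
      (hne hl' fun l n => (hd l n).2),
    psiHalf_add_one hM _ τ z₁ z₂ hl hl', psiHalf_add_one hM _ τ z₂ z₁ hl' hl,
    mul_right_comm _ k j, Nat.cast_succ]
  ring

theorem theorem7p1 (M m : ℕ) (hM : 0 < M) (hcop : 0 < m → Nat.Coprime M (2 * m + 2))
    (ε ε' : ℂ) (hε : ε = 0 ∨ ε = 1 / 2) (hε' : ε' = 0 ∨ ε' = 1 / 2)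
    (j k : ℂ) (hj : ∃ n : ℤ, j = ε' + n) (hk : ∃ n : ℤ, k = ε' + n)
    (τ z₁ z₂ t : ℂ) (hτ : 0 < τ.im) :
    -- the transformation under `τ ↦ -1/τ`, for any set `S` of representatives of the
    -- summation range `(ℤ/Mℤ)²`, at every point where all the summands are defined
    (∀ S : Finset (ℤ × ℤ),
      Set.BijOn (fun p : ℤ × ℤ => ((p.1 : ZMod M), (p.2 : ZMod M))) (S : Set (ℤ × ℤ)) Set.univ →
      (∀ p ∈ S, PsiDefinedAt M ε' (ε + p.1) (ε + p.2) τ z₁ z₂) →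
      modPsi M m ε j k (-1 / τ) (z₁ / τ) (z₂ / τ) t =
        τ / M * cexp (2 * Real.pi * I * (m + 1) * z₁ * z₂ / (M * τ)) *
          ∑ p ∈ S,
            cexp (-(2 * Real.pi * I * (m + 1) / M * ((ε + p.1) * k + (ε + p.2) * j)))
              * modPsi M m ε' (ε + p.1) (ε + p.2) τ z₁ z₂ t) ∧
    -- the transformation under `τ ↦ τ + 1`, where the superscript `ε + ε'` may be replaced
    -- by any number congruent to it modulo `ℤ`
    (PsiDefinedAt M ε j k (τ + 1) z₁ z₂ →
      ∀ ε'' : ℂ, (∃ n : ℤ, ε'' = ε + ε' + n) →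
        modPsi M m ε j k (τ + 1) z₁ z₂ t =
          cexp (2 * Real.pi * I * ((m + 1) * j * k / M)) * modPsi M m ε'' j k τ z₁ z₂ t) := by
  obtain ⟨e, he⟩ := exists_add_self_eq_intCast hε'
  obtain ⟨n, rfl⟩ := hj
  obtain ⟨n', rfl⟩ := hk
  -- For `m = 0` the multiplier `m + 1` is 1, so coprimality is automatic.
  have hKM : Nat.Coprime (m + 1) M := by
    rcases Nat.eq_zero_or_pos m with rfl | hm
    · exact Nat.coprime_one_left M
    · exact ((hcop hm).coprime_dvd_right ⟨2, by ring⟩).symm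
  have hεc := conj_eq_self_of_half hε
  have hε'c := conj_eq_self_of_half hε'
  refine ⟨fun S hS hdef => ?_, fun hdef ε'' ⟨l, hl⟩ => ?_⟩
  · exact modPsi_neg_inv hM hKM z₁ z₂ t (h := e + n) (h' := e + n') hτ hεc hε'c
      (by push_cast; linear_combination he) (by push_cast; linear_combination he) S hS hdef
  · exact modPsi_add_one hM m t (l := n - l) (l' := n' - l) hτ hεc (conj_add_intCast hε'c n)
      (conj_add_intCast hε'c n') (by push_cast; linear_combination -hl)
      (by push_cast; linear_combination -hl) hdef
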